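/- A code $\mathsf{C}\colon\{0,1\}^k\to\{0,1\}^n$ is called $(q,\delta,\varepsilon)$-locally decodable if there is a randomized, possibly adaptive, decoding algorithm $\mathrm{Dec}$ that takes an index $i\in[k]$ as input, has oracle access to a string $y\in\{0,1\}^n$, always makes at most $q$ queries to coordinates of $y$, and satisfies $\Pr[\mathrm{Dec}^{y}(i)=b_i]\ge \frac12+\varepsilon$ for all $b\in\{0,1\}^k$, all $i\in[k]$, and all $y\in\{0,1\}^n$ such that $|\{v\in[n] : y_v\ne \mathsf{C}(b)_v\}|\le\delta n$. **Theorem.** (1) There is an absolute constant $K>0$ such that for all $k\ge 0$, $n\ge 2$, $\delta>0$, $\varepsilon>0$, every $(3,\delta,\varepsilon)$-locally decodable code $\mathsf{C}\colon\{0,1\}^k\to\{0,1\}^n$ satisfies $$k^3\le n\cdot K\cdot\frac{\log^6 n}{\varepsilon^{32}\,\delta^{16}}.$$ (2) In particular, for all constants $\delta,\varepsilon>0$ there is a $c>0$, depending only on $\delta$ and $\varepsilon$, such that every $(3,\delta,\varepsilon)$-locally decodable code $\mathsf{C}\colon\{0,1\}^k\to\{0,1\}^n$ with $k\ge2$ satisfies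 $n\ge c\,k^3/\log^6 k$. -/

import Mathlib

/-- A deterministic (adaptive) algorithm with oracle access to a string `y` in `{0,1}^n`, as a query
tree: it either halts with an output bit, or queries a coordinate `v` of the oracle and continues
in a way that depends on the answer. -/
inductive QueryAlgorithm (n : ℕ) : Type
  | output (a : Bool) : QueryAlgorithm n
  | query (v : Fin n) (next : Bool → QueryAlgorithm n) : QueryAlgorithm n

namespace QueryAlgorithm

/-- The output of the algorithm when it is run with oracle `y`. -/
def run {n : ℕ} (y : Fin n → Bool) : QueryAlgorithm n → Bool
  | output a => a
  | query v next => run y (next (y v))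

/-- The number of queries that the algorithm makes when it is run with oracle `y`. -/
def queryCount {n : ℕ} (y : Fin n → Bool) : QueryAlgorithm n → ℕ
  | output _ => 0
  | query v next => queryCount y (next (y v)) + 1

end QueryAlgorithm

/-- The code `C : {0,1}^k → {0,1}^n` is `(q, δ, ε)`-locally decodable. The randomized decoder is,
for each input `i`, a probability distribution `dec i` on deterministic adaptive oracle algorithms
(the law of the algorithm obtained by fixing the random coins). Whatever the coins and the oracle,
it makes at most `q` queries, and if the oracle `y` is within Hamming distance `δ n` of `C b`, then
it outputs `b i` with probability at least `1/2 + ε`. -/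
def IsLocallyDecodable {k n : ℕ} (q : ℕ) (δ ε : ℝ)
    (C : (Fin k → Bool) → (Fin n → Bool)) : Prop :=
  ∃ dec : Fin k → PMF (QueryAlgorithm n),
    (∀ i : Fin k, ∀ A ∈ (dec i).support, ∀ y : Fin n → Bool, A.queryCount y ≤ q) ∧
    (∀ (b : Fin k → Bool) (i : Fin k) (y : Fin n → Bool),
      (hammingDist y (C b) : ℝ) ≤ δ * (n : ℝ) →
        1 / 2 + ε ≤ (((dec i).map (fun A => A.run y)) (b i)).toReal)

open Finset

/-! A decoder with three queries correlates, for each message bit `b i`, with a parity of at most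
three codeword bits, and keeps doing so after any `δ n` coordinates are erased. Hence each `i` has a
matching of `m ≥ δ n / 3` triples whose signed parities correlate with `b i` (`exists_matching`,
`exists_normalForm`), and the sum over `i` of `± b i` times these parities has average of order at
least `ε m k`. The proof bounds this average from above.

The main tool is a Khintchine inequality for matrices (`sum_quadraticForm_le`): on average, a random
signed sum of `k` symmetric matrices of size `N` with absolute row sums at most `D` has quadratic
form at most about `D √(k log N)` on unit vectors, even on vectors that depend on the signs.

A pair of vertices lying in more than `d ≈ n log n / (ε² m)` triples is heavy. There are few heavy
pairs, so treating a heavy pair as one symbol turns its triples into edges of a sparse bipartite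
2-query system; Khintchine then shows that they carry at most half of the correlation
(`sum_heavy_le`).

For the light triples `(u, v, w)`, Cauchy-Schwarz over `u` removes the first coordinate and leaves
products of four signs, from triples of matchings `i` and `j` that share `u`. A cut `L` keeps the
terms with `i ∈ L` and `j ∉ L`; once the bits outside `L` are fixed, this is a signed sum over `i ∈
L` of quadratic forms. These forms are realised on a Kikuchi graph whose states are pairs of
sequences of length `ℓ`. Lightness bounds the second moment of its degrees, so the states of large
degree can be pruned cheaply (`sum_moves_le`, `sum_crossParity_le`), and Khintchine applies in
dimension `|V|^(2ℓ)`.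

The outcome is `light_tradeoff`. For constant `δ` and `ε`, taking `ℓ ≈ √(n log n / k)` makes the
mean degree comparable to `d` and gives `k ≲ ℓ log n`, that is `k³ ≲ n log³ n`
(`cube_le_of_tradeoff`). -/

/-- The sign `(-1)^a` of a bit. -/
noncomputable def bitSign (a : Bool) : ℝ := if a then -1 else 1

lemma bitSign_mul_self (a : Bool) : bitSign a * bitSign a = 1 := by
  cases a <;> simp [bitSign]

lemma abs_bitSign (a : Bool) : |bitSign a| = 1 := by
  cases a <;> simp [bitSign]

/-- The Walsh character of the discrete cube indexed by `A`. -/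
noncomputable def walsh {ι : Type*} (A : Finset ι) (b : ι → Bool) : ℝ := ∏ i ∈ A, bitSign (b i)

/-! ### Walsh expansion of powers of signed sums in a noncommutative algebra. -/

section Walsh

variable {ι : Type*} [DecidableEq ι]

lemma walsh_symmDiff_singleton (A : Finset ι) (i : ι) (b : ι → Bool) :
    walsh (symmDiff A {i}) b = walsh A b * bitSign (b i) := by
  unfold walsh
  by_cases h : i ∈ A
  · have : symmDiff A {i} = A.erase i := by
      ext j; simp [Finset.mem_symmDiff]; grind
    rw [this, ← Finset.mul_prod_erase A _ h]
    rw [mul_right_comm, bitSign_mul_self, one_mul]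
  · have : symmDiff A {i} = insert i A := by
      ext j; simp [Finset.mem_symmDiff]; grind
    rw [this, Finset.prod_insert h, mul_comm]

lemma sum_walsh [Fintype ι] (A : Finset ι) :
    ∑ b : ι → Bool, walsh A b = if A = ∅ then 2 ^ Fintype.card ι else 0 := by
  split_ifs with h
  · simp [h, walsh]
  · obtain ⟨i, hi⟩ := Finset.nonempty_iff_ne_empty.2 h
    have key : ∑ b : ι → Bool, walsh A b = ∏ i, ∑ a : Bool, if i ∈ A then bitSign a else 1 := by
      rw [Finset.prod_univ_sum, Fintype.piFinset_univ]
      refine Finset.sum_congr rfl fun b _ => ?_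
      rw [walsh, Finset.prod_ite_mem, Finset.univ_inter]
    rw [key]
    exact Finset.prod_eq_zero (Finset.mem_univ i) (by simp [hi, bitSign])

variable [Fintype ι] {R : Type*} [Ring R] [Algebra ℝ R]

/-- The Walsh coefficients of the `q`-th power of the random sum `∑ i, ± B i`. -/
def walshCoeff (B : ι → R) : ℕ → Finset ι → R
  | 0, A => if A = ∅ then 1 else 0
  | q + 1, A => ∑ i, walshCoeff B q (symmDiff A {i}) * B i

/-- Signs commute with everything, so each word in the `B i` contributes to the character of the set
of indices that it uses an odd number of times. -/
lemma signedSum_pow (B : ι → R) (q : ℕ) (b : ι → Bool) :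
    (∑ i, bitSign (b i) • B i) ^ q = ∑ A : Finset ι, walsh A b • walshCoeff B q A := by
  induction q with
  | zero => simp [walshCoeff, walsh]
  | succ q ih =>
    rw [pow_succ, ih, Finset.mul_sum]
    simp only [walshCoeff, Finset.smul_sum]
    rw [Finset.sum_comm (s := univ (α := Finset ι))]
    refine Finset.sum_congr rfl fun i _ => ?_
    rw [Finset.sum_mul]
    have hinv : Function.Involutive fun A : Finset ι => symmDiff A {i} := fun A => by
      simp
    refine Fintype.sum_equiv hinv.toPerm _ _ fun A => ?_
    have : symmDiff (symmDiff A {i}) {i} = A := hinv A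
    simp only [Function.Involutive.coe_toPerm, this, walsh_symmDiff_singleton]
    rw [smul_mul_smul_comm]

lemma sum_signedSum_pow (B : ι → R) (q : ℕ) :
    ∑ b : ι → Bool, (∑ i, bitSign (b i) • B i) ^ q =
      ((2 : ℝ) ^ Fintype.card ι) • walshCoeff B q ∅ := by
  simp only [signedSum_pow]
  rw [Finset.sum_comm]
  simp only [← Finset.sum_smul, sum_walsh]
  simp

end Walsh

/-! ### Even moments of Rademacher sums. -/

section Moment

variable {ι : Type*} [Fintype ι] [DecidableEq ι]

lemma sum_exp_signedSum (t : ℝ) :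
    ∑ b : ι → Bool, Real.exp (t * ∑ i, bitSign (b i)) ≤
      2 ^ Fintype.card ι * Real.exp (Fintype.card ι * t ^ 2 / 2) := by
  have key : ∑ b : ι → Bool, Real.exp (t * ∑ i, bitSign (b i)) =
      ∏ _i : ι, ∑ a : Bool, Real.exp (t * bitSign a) := by
    rw [Finset.prod_univ_sum, Fintype.piFinset_univ]
    refine Finset.sum_congr rfl fun b _ => ?_
    rw [Finset.mul_sum, Real.exp_sum]
  have h2 : ∑ a : Bool, Real.exp (t * bitSign a) = 2 * Real.cosh t := by
    simp [bitSign, Real.cosh_eq]; ring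
  rw [key, h2, Finset.prod_const, Finset.card_univ, mul_pow]
  have h3 : Real.cosh t ^ Fintype.card ι ≤ Real.exp (t ^ 2 / 2) ^ Fintype.card ι :=
    pow_le_pow_left₀ (Real.cosh_pos t).le (Real.cosh_le_exp_half_sq t) _
  rw [← Real.exp_nat_mul] at h3
  calc (2 : ℝ) ^ Fintype.card ι * Real.cosh t ^ Fintype.card ι
      ≤ 2 ^ Fintype.card ι * Real.exp (Fintype.card ι * (t ^ 2 / 2)) := by gcongr
    _ = _ := by rw [mul_div_assoc]

/-- The moments of even order of a Rademacher sum are at most those of a Gaussian, up to constants. -/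
lemma sum_signedSum_pow_le (p : ℕ) (hp : 1 ≤ p) :
    ∑ b : ι → Bool, (∑ i, bitSign (b i)) ^ (2 * p) ≤
      2 ^ Fintype.card ι * (2 * (2 * p * Fintype.card ι * Real.exp 1) ^ p) := by
  rcases Nat.eq_zero_or_pos (Fintype.card ι) with h0 | hpos
  · have : IsEmpty ι := Fintype.card_eq_zero_iff.1 h0
    simp only [Finset.univ_eq_empty, Finset.sum_empty]
    rw [zero_pow (by omega)]
    simp only [Finset.sum_const_zero]
    positivity
  set k : ℝ := ((Fintype.card ι : ℕ) : ℝ) with hk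
  have hk0 : 0 < k := Nat.cast_pos.2 hpos
  have hp0 : (0 : ℝ) < p := by exact_mod_cast hp
  -- This `t` makes the sub-Gaussian factor `exp (k t² / 2)` equal to `exp p`.
  set t : ℝ := Real.sqrt (2 * p / k) with ht
  have ht2 : t ^ 2 = 2 * p / k := Real.sq_sqrt (by positivity)
  have htp : t ^ (2 * p) = (2 * p / k) ^ p := by rw [pow_mul, ht2]
  have pt : ∀ X : ℝ, X ^ (2 * p) ≤ (2 * p * k) ^ p * (Real.exp (t * X) + Real.exp (-t * X)) := by
    intro X
    have h1 := Real.pow_div_factorial_le_exp |t * X| (abs_nonneg _) (2 * p)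
    rw [Even.pow_abs (even_two_mul p), mul_pow, htp] at h1
    have h2 : Real.exp |t * X| ≤ Real.exp (t * X) + Real.exp (-t * X) := by
      rcases abs_cases (t * X) with h | h <;> rw [h.1]
      · linarith [Real.exp_pos (-t * X)]
      · rw [← neg_mul]; linarith [Real.exp_pos (t * X)]
    have hf : ((2 * p).factorial : ℝ) ≤ (2 * p) ^ (2 * p) := by
      exact_mod_cast Nat.factorial_le_pow (2 * p)
    have hf0 : (0 : ℝ) < (2 * p).factorial := by exact_mod_cast Nat.factorial_pos _
    have h3 : (2 * p / k) ^ p * X ^ (2 * p) ≤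
        (2 * p) ^ (2 * p) * (Real.exp (t * X) + Real.exp (-t * X)) := by
      rw [div_le_iff₀ hf0] at h1
      calc _ ≤ Real.exp |t * X| * (2 * p).factorial := h1
        _ ≤ (Real.exp (t * X) + Real.exp (-t * X)) * (2 * p) ^ (2 * p) := by gcongr
        _ = _ := mul_comm _ _
    have h4 : ((2 * p : ℝ)) ^ (2 * p) = (2 * p / k) ^ p * (2 * p * k) ^ p := by
      rw [← mul_pow, pow_mul]; congr 1; field_simp
    rw [h4, mul_assoc] at h3
    exact le_of_mul_le_mul_left h3 (by positivity)
  calc ∑ b : ι → Bool, (∑ i, bitSign (b i)) ^ (2 * p)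
      ≤ ∑ b : ι → Bool, (2 * p * k) ^ p * (Real.exp (t * ∑ i, bitSign (b i)) +
          Real.exp (-t * ∑ i, bitSign (b i))) := Finset.sum_le_sum fun b _ => pt _
    _ = (2 * p * k) ^ p * (∑ b : ι → Bool, Real.exp (t * ∑ i, bitSign (b i)) +
          ∑ b : ι → Bool, Real.exp (-t * ∑ i, bitSign (b i))) := by
        rw [← Finset.mul_sum, Finset.sum_add_distrib]
    _ ≤ (2 * p * k) ^ p * (2 ^ Fintype.card ι * Real.exp (Fintype.card ι * t ^ 2 / 2) +
          2 ^ Fintype.card ι * Real.exp (Fintype.card ι * (-t) ^ 2 / 2)) := by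
        gcongr <;> exact sum_exp_signedSum _
    _ = _ := by
        have h5 : k * t ^ 2 / 2 = p * 1 := by rw [ht2]; field_simp
        rw [neg_sq, ← hk, h5, Real.exp_nat_mul, mul_pow _ (Real.exp 1)]
        ring

end Moment

/-! ### A noncommutative Khintchine inequality by the trace method. -/

section Khintchine

open Matrix

variable {ι V : Type*} [Fintype ι] [DecidableEq ι] [Fintype V] [DecidableEq V]

/-- Absolute row sums are submultiplicative and the recursion for the coefficients has only positive
terms, so each matrix may be replaced by the scalar `D`. This reduces trace moments to scalar
Rademacher moments, whatever the commutation relations. -/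
lemma sum_abs_walshCoeff_le (B : ι → Matrix V V ℝ) {D : ℝ}
    (hrow : ∀ i S, ∑ T, |B i S T| ≤ D) (q : ℕ) (A : Finset ι) (S : V) :
    ∑ T, |walshCoeff B q A S T| ≤ walshCoeff (fun _ : ι => D) q A := by
  induction q generalizing A S with
  | zero =>
    simp only [walshCoeff]
    split_ifs
    · simp [Matrix.one_apply, apply_ite abs]
    · simp
  | succ q ih =>
    simp only [walshCoeff]
    calc ∑ T, |(∑ i, walshCoeff B q (symmDiff A {i}) * B i) S T|
        ≤ ∑ T, ∑ i, ∑ U, |walshCoeff B q (symmDiff A {i}) S U| * |B i U T| := by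
          refine Finset.sum_le_sum fun T _ => ?_
          rw [Matrix.sum_apply]
          refine (Finset.abs_sum_le_sum_abs _ _).trans (Finset.sum_le_sum fun i _ => ?_)
          rw [Matrix.mul_apply]
          refine (Finset.abs_sum_le_sum_abs _ _).trans (Finset.sum_le_sum fun U _ => ?_)
          rw [abs_mul]
      _ = ∑ i, ∑ U, |walshCoeff B q (symmDiff A {i}) S U| * ∑ T, |B i U T| := by
          rw [Finset.sum_comm]
          refine Finset.sum_congr rfl fun i _ => ?_
          rw [Finset.sum_comm]
          simp only [Finset.mul_sum]
      _ ≤ ∑ i, ∑ U, |walshCoeff B q (symmDiff A {i}) S U| * D := by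
          gcongr with i _ U _
          exact hrow i U
      _ ≤ ∑ i, walshCoeff (fun _ : ι => D) q (symmDiff A {i}) * D := by
          refine Finset.sum_le_sum fun i _ => ?_
          rw [← Finset.sum_mul]
          have hD : 0 ≤ D := (Finset.sum_nonneg fun T _ => abs_nonneg _).trans (hrow i S)
          exact mul_le_mul_of_nonneg_right (ih _ _) hD

lemma sum_trace_signedSum_pow_le (B : ι → Matrix V V ℝ) {D : ℝ}
    (hrow : ∀ i S, ∑ T, |B i S T| ≤ D) (q : ℕ) :
    ∑ b : ι → Bool, ((∑ i, bitSign (b i) • B i) ^ q).trace ≤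
      Fintype.card V * (D ^ q * ∑ b : ι → Bool, (∑ i, bitSign (b i)) ^ q) := by
  rw [← Matrix.trace_sum, sum_signedSum_pow, Matrix.trace_smul]
  have h1 : (walshCoeff B q ∅).trace ≤ Fintype.card V * walshCoeff (fun _ : ι => D) q ∅ := by
    rw [Matrix.trace]
    calc ∑ S, (walshCoeff B q ∅).diag S
        ≤ ∑ _S : V, walshCoeff (fun _ : ι => D) q ∅ := by
          refine Finset.sum_le_sum fun S _ => ?_
          refine le_trans ?_ (sum_abs_walshCoeff_le B hrow q ∅ S)
          exact (le_abs_self _).trans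
            (Finset.single_le_sum (f := fun T => |walshCoeff B q ∅ S T|)
              (fun _ _ => abs_nonneg _) (Finset.mem_univ S))
      _ = _ := by simp
  have h2 := sum_signedSum_pow (fun _ : ι => D) q
  simp only [smul_eq_mul, ← Finset.sum_mul, mul_pow] at h2
  rw [mul_comm (D ^ q), h2, smul_eq_mul]
  calc _ ≤ (2 : ℝ) ^ Fintype.card ι * (Fintype.card V * walshCoeff (fun _ : ι => D) q ∅) := by
        gcongr
    _ = _ := by ring

/-- Repeated Cauchy-Schwarz replaces `M` by `M ^ 2` and doubles the exponent; the base case bounds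
the form by the Hilbert-Schmidt norm. This is why the exponents are powers of two. -/
lemma quadraticForm_pow_le (M : Matrix V V ℝ) (hM : M.IsSymm) (z : V → ℝ) (r : ℕ) :
    (z ⬝ᵥ M *ᵥ z) ^ 2 ^ (r + 1) ≤ (z ⬝ᵥ z) ^ 2 ^ (r + 1) * (M ^ 2 ^ (r + 1)).trace := by
  have hz : 0 ≤ z ⬝ᵥ z := Finset.sum_nonneg fun i _ => mul_self_nonneg _
  induction r generalizing M with
  | zero =>
    have h1 : (z ⬝ᵥ M *ᵥ z) ^ 2 ≤ (z ⬝ᵥ z) * ((M *ᵥ z) ⬝ᵥ (M *ᵥ z)) := by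
      have := Finset.sum_mul_sq_le_sq_mul_sq univ z (M *ᵥ z)
      simpa [dotProduct, pow_two] using this
    have h2 : (M *ᵥ z) ⬝ᵥ (M *ᵥ z) ≤ (M ^ 2).trace * (z ⬝ᵥ z) := by
      have h3 : (M ^ 2).trace = ∑ S, ∑ T, M S T ^ 2 := by
        rw [pow_two, Matrix.trace]
        refine Finset.sum_congr rfl fun S _ => ?_
        rw [Matrix.diag_apply, Matrix.mul_apply]
        refine Finset.sum_congr rfl fun T _ => ?_
        rw [hM.apply, pow_two]
      rw [h3, Finset.sum_mul]
      refine Finset.sum_le_sum fun S _ => ?_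
      have := Finset.sum_mul_sq_le_sq_mul_sq univ (M S) z
      simpa [Matrix.mulVec, dotProduct, pow_two] using this
    calc _ ≤ (z ⬝ᵥ z) * ((M *ᵥ z) ⬝ᵥ (M *ᵥ z)) := by simpa using h1
      _ ≤ (z ⬝ᵥ z) * ((M ^ 2).trace * (z ⬝ᵥ z)) := by gcongr
      _ = _ := by simp; ring
  | succ r ih =>
    have h1 : (z ⬝ᵥ M *ᵥ z) ^ 2 ≤ (z ⬝ᵥ z) * (z ⬝ᵥ (M ^ 2) *ᵥ z) := by
      have := Finset.sum_mul_sq_le_sq_mul_sq univ z (M *ᵥ z)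
      have h2 : z ⬝ᵥ (M ^ 2) *ᵥ z = (M *ᵥ z) ⬝ᵥ (M *ᵥ z) := by
        rw [pow_two, ← Matrix.mulVec_mulVec, Matrix.dotProduct_mulVec, ← Matrix.mulVec_transpose,
          hM.eq]
      rw [h2]
      simpa [dotProduct, pow_two] using this
    have hs : (M ^ 2).IsSymm := hM.pow 2
    have h3 := ih (M ^ 2) hs
    rw [← pow_mul, ← pow_succ'] at h3
    have e : 2 ^ (r + 1 + 1) = 2 * 2 ^ (r + 1) := pow_succ' 2 (r + 1)
    calc (z ⬝ᵥ M *ᵥ z) ^ 2 ^ (r + 1 + 1) = ((z ⬝ᵥ M *ᵥ z) ^ 2) ^ 2 ^ (r + 1) := by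
          rw [e, pow_mul]
      _ ≤ ((z ⬝ᵥ z) * (z ⬝ᵥ (M ^ 2) *ᵥ z)) ^ 2 ^ (r + 1) :=
          pow_le_pow_left₀ (sq_nonneg _) h1 _
      _ = (z ⬝ᵥ z) ^ 2 ^ (r + 1) * (z ⬝ᵥ (M ^ 2) *ᵥ z) ^ 2 ^ (r + 1) := mul_pow _ _ _
      _ ≤ (z ⬝ᵥ z) ^ 2 ^ (r + 1) *
          ((z ⬝ᵥ z) ^ 2 ^ (r + 1) * (M ^ 2 ^ (r + 1 + 1)).trace) := by gcongr
      _ = _ := by rw [e, two_mul, pow_add]; ring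

/-- A noncommutative Khintchine inequality: signed sums of symmetric matrices with bounded
absolute row sums have small quadratic forms on average, even on vectors that depend on the
signs. -/
theorem sum_quadraticForm_le [Nonempty V] (B : ι → Matrix V V ℝ) (hB : ∀ i, (B i).IsSymm)
    {D : ℝ} (hD : 0 ≤ D) (hrow : ∀ i S, ∑ T, |B i S T| ≤ D)
    (z : (ι → Bool) → V → ℝ) {Z : ℝ} (hZ : 0 ≤ Z) (hz : ∀ b, z b ⬝ᵥ z b ≤ Z) :
    ∑ b : ι → Bool, ∑ i, bitSign (b i) * (z b ⬝ᵥ B i *ᵥ z b) ≤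
      2 ^ Fintype.card ι *
        (Z * D * √(128 * Fintype.card ι * (Real.log (Fintype.card V) + 1))) := by
  set k : ℝ := ((Fintype.card ι : ℕ) : ℝ) with hk
  have hk0 : 0 ≤ k := Nat.cast_nonneg _
  have hV : (1 : ℝ) ≤ Fintype.card V := by exact_mod_cast Fintype.card_pos
  have hlog : 0 ≤ Real.log (Fintype.card V) := Real.log_nonneg hV
  -- The moment `2 p = 2 ^ (r + 1)` is comparable to `log |V|`: then `|V| ≤ exp (2 p)`, and the
  -- dimension costs only a constant factor after the `2 p`-th root is taken.
  obtain ⟨r, hr1, hr2⟩ := exists_nat_pow_near (x := Real.log (Fintype.card V) + 1)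
    (by linarith) (one_lt_two)
  set x : ℝ := Real.log (Fintype.card V) + 1 with hx
  set M : (ι → Bool) → Matrix V V ℝ := fun b => ∑ i, bitSign (b i) • B i with hMdef
  have hM : ∀ b, (M b).IsSymm := fun b => by
    simp only [hMdef, Matrix.IsSymm, Matrix.transpose_sum, Matrix.transpose_smul, (hB _).eq]
  have hform : ∀ b, ∑ i, bitSign (b i) * (z b ⬝ᵥ B i *ᵥ z b) = z b ⬝ᵥ M b *ᵥ z b := fun b => by
    simp only [hMdef, Matrix.sum_mulVec, dotProduct_sum, Matrix.smul_mulVec, dotProduct_smul,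
      smul_eq_mul]
  simp only [hform]
  set p : ℕ := 2 ^ r with hp
  have hp1 : 1 ≤ p := Nat.one_le_two_pow
  have hq : 2 ^ (r + 1) = 2 * p := pow_succ' 2 r
  have hpx : (p : ℝ) ≤ x := by rw [hp]; push_cast; exact hr1
  have hxp : x < 2 * p := by rw [pow_succ'] at hr2; rw [hp]; push_cast; exact hr2
  have htr : ∀ b, 0 ≤ ((M b) ^ (2 * p)).trace := fun b => by
    have h1 : ((M b) ^ p).IsSymm := (hM b).pow p
    rw [two_mul, pow_add, Matrix.trace]
    refine Finset.sum_nonneg fun S _ => ?_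
    rw [Matrix.diag_apply, Matrix.mul_apply]
    refine Finset.sum_nonneg fun T _ => ?_
    rw [h1.apply]
    exact mul_self_nonneg _
  have h1 : ∑ b, (z b ⬝ᵥ M b *ᵥ z b) ^ (2 * p) ≤
      Z ^ (2 * p) * (Fintype.card V * (D ^ (2 * p) *
        (2 ^ Fintype.card ι * (2 * (2 * p * k * Real.exp 1) ^ p)))) := by
    calc _ ≤ ∑ b, Z ^ (2 * p) * ((M b) ^ (2 * p)).trace := by
          refine Finset.sum_le_sum fun b _ => ?_
          have := quadraticForm_pow_le (M b) (hM b) (z b) r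
          rw [hq] at this
          refine this.trans ?_
          have h0 : 0 ≤ z b ⬝ᵥ z b := Finset.sum_nonneg fun i _ => mul_self_nonneg _
          exact mul_le_mul_of_nonneg_right (pow_le_pow_left₀ h0 (hz b) _) (htr b)
      _ ≤ _ := by
          rw [← Finset.mul_sum]
          refine mul_le_mul_of_nonneg_left ?_ (by positivity)
          refine (sum_trace_signedSum_pow_le B hrow (2 * p)).trans ?_
          gcongr
          exact sum_signedSum_pow_le p hp1
  have hcard : (∑ _b : ι → Bool, ((2 : ℝ) ^ Fintype.card ι)⁻¹) = 1 := by
    simp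
  have h2 := Real.pow_arith_mean_le_arith_mean_pow_of_even univ
    (fun _ : ι → Bool => ((2 : ℝ) ^ Fintype.card ι)⁻¹) (fun b => z b ⬝ᵥ M b *ᵥ z b)
    (fun _ _ => by positivity) hcard (even_two_mul p)
  rw [← Finset.mul_sum, ← Finset.mul_sum] at h2
  have hVp : (Fintype.card V : ℝ) ≤ (Real.exp 1 ^ 2) ^ p := by
    rw [← pow_mul, ← Real.exp_nat_mul, ← Real.log_le_iff_le_exp (by linarith)]
    push_cast
    linarith
  have hexp : Real.exp 1 ^ 3 ≤ 32 := by
    have := Real.exp_one_lt_d9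
    calc Real.exp 1 ^ 3 ≤ 3 ^ 3 := by gcongr; linarith
      _ ≤ 32 := by norm_num
  have h3 : (Fintype.card V : ℝ) * (2 * (2 * p * k * Real.exp 1) ^ p) ≤ (128 * k * x) ^ p := by
    have h2p : (2 : ℝ) ≤ 2 ^ p := by
      calc (2 : ℝ) = 2 ^ 1 := by norm_num
        _ ≤ 2 ^ p := pow_le_pow_right₀ (by norm_num) hp1
    calc (Fintype.card V : ℝ) * (2 * (2 * p * k * Real.exp 1) ^ p)
        ≤ (Real.exp 1 ^ 2) ^ p * (2 ^ p * (2 * p * k * Real.exp 1) ^ p) := by gcongr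
      _ = (Real.exp 1 ^ 3 * (4 * p * k)) ^ p := by
          rw [← mul_pow, ← mul_pow]; ring
      _ ≤ (32 * (4 * x * k)) ^ p := by gcongr
      _ = _ := by ring
  set A : ℝ := ((2 : ℝ) ^ Fintype.card ι)⁻¹ * ∑ b, z b ⬝ᵥ M b *ᵥ z b with hA
  set Q : ℝ := √(128 * k * x) with hQ
  have hQ2 : Q ^ (2 * p) = (128 * k * x) ^ p := by
    rw [pow_mul, hQ, Real.sq_sqrt (by positivity)]
  have h4 : A ^ (2 * p) ≤ (Z * D * Q) ^ (2 * p) := by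
    calc A ^ (2 * p) ≤ ((2 : ℝ) ^ Fintype.card ι)⁻¹ * ∑ b, (z b ⬝ᵥ M b *ᵥ z b) ^ (2 * p) := h2
      _ ≤ ((2 : ℝ) ^ Fintype.card ι)⁻¹ * (Z ^ (2 * p) * (Fintype.card V * (D ^ (2 * p) *
        (2 ^ Fintype.card ι * (2 * (2 * p * k * Real.exp 1) ^ p))))) := by gcongr
      _ = Z ^ (2 * p) * D ^ (2 * p) *
          (Fintype.card V * (2 * (2 * p * k * Real.exp 1) ^ p)) := by
          field_simp
      _ ≤ Z ^ (2 * p) * D ^ (2 * p) * (128 * k * x) ^ p := by gcongr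
      _ = _ := by rw [← hQ2, mul_pow (Z * D), mul_pow Z]
  have h5 : A ≤ Z * D * Q := by
    by_contra h
    exact absurd h4 (not_le.2 (pow_lt_pow_left₀ (not_le.1 h) (by positivity) (by omega)))
  rw [hA, inv_mul_le_iff₀ (by positivity)] at h5
  exact h5

/-- The rectangular form of `sum_quadraticForm_le`. -/
theorem sum_bilinearForm_le {W : Type*} [Fintype W] [DecidableEq W] [Nonempty V]
    (B : ι → Matrix W V ℝ) (hrow : ∀ i S, ∑ T, |B i S T| ≤ 1) (hcol : ∀ i T, ∑ S, |B i S T| ≤ 1)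
    (y : (ι → Bool) → W → ℝ) (z : (ι → Bool) → V → ℝ) {Y Z : ℝ} (hY : 0 < Y) (hZ : 0 < Z)
    (hy : ∀ b, y b ⬝ᵥ y b ≤ Y) (hz : ∀ b, z b ⬝ᵥ z b ≤ Z) :
    ∑ b : ι → Bool, ∑ i, bitSign (b i) * (y b ⬝ᵥ B i *ᵥ z b) ≤
      2 ^ Fintype.card ι * (√(Y * Z) *
        √(128 * Fintype.card ι * (Real.log (Fintype.card W + Fintype.card V) + 1))) := by
  -- Rescaling `y` by `c` and `z` by `c⁻¹` leaves the bilinear form unchanged and balances both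
  -- squared norms at `√(Y Z)`.
  set c : ℝ := √(√(Z / Y)) with hc
  have hc0 : 0 < c := Real.sqrt_pos.2 (Real.sqrt_pos.2 (by positivity))
  have hc2 : c ^ 2 = √(Z / Y) := Real.sq_sqrt (Real.sqrt_nonneg _)
  have hYZ : c ^ 2 * Y = √(Y * Z) := by
    rw [hc2, Real.sqrt_div hZ.le, Real.sqrt_mul hY.le, div_mul_eq_mul_div,
      div_eq_iff (Real.sqrt_ne_zero'.2 hY)]
    linear_combination -√Z * Real.mul_self_sqrt hY.le
  have hZY : (c⁻¹) ^ 2 * Z = √(Y * Z) := by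
    rw [inv_pow, hc2, Real.sqrt_div hZ.le, Real.sqrt_mul hY.le, inv_div, div_mul_eq_mul_div,
      div_eq_iff (Real.sqrt_ne_zero'.2 hZ)]
    linear_combination -√Y * Real.mul_self_sqrt hZ.le
  -- The symmetric dilation of `B i`; its quadratic form on the joined vector is twice the bilinear
  -- form.
  have key := sum_quadraticForm_le (V := W ⊕ V)
    (fun i => Matrix.fromBlocks 0 (B i) (B i)ᵀ 0)
    (fun i => by simp [Matrix.IsSymm, Matrix.fromBlocks_transpose]) zero_le_one
    (fun i S => by
      rcases S with S | S
      · simpa using hrow i S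
      · simpa using hcol i S)
    (fun b => Sum.elim (c • y b) (c⁻¹ • z b)) (Z := 2 * √(Y * Z)) (by positivity)
    (fun b => by
      simp only [dotProduct, Fintype.sum_sum_type, Sum.elim_inl, Sum.elim_inr, Pi.smul_apply,
        smul_eq_mul]
      have h1 : ∑ x, c * y b x * (c * y b x) = c ^ 2 * (y b ⬝ᵥ y b) := by
        rw [dotProduct, Finset.mul_sum]; exact Finset.sum_congr rfl fun _ _ => by ring
      have h2 : ∑ x, c⁻¹ * z b x * (c⁻¹ * z b x) = (c⁻¹) ^ 2 * (z b ⬝ᵥ z b) := by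
        rw [dotProduct, Finset.mul_sum]; exact Finset.sum_congr rfl fun _ _ => by ring
      rw [h1, h2, two_mul]
      refine add_le_add ?_ ?_
      · rw [← hYZ]; exact mul_le_mul_of_nonneg_left (hy b) (by positivity)
      · rw [← hZY]; exact mul_le_mul_of_nonneg_left (hz b) (by positivity))
  have hform : ∀ b i, (Sum.elim (c • y b) (c⁻¹ • z b) : W ⊕ V → ℝ) ⬝ᵥ
      Matrix.fromBlocks 0 (B i) (B i)ᵀ 0 *ᵥ (Sum.elim (c • y b) (c⁻¹ • z b)) =
      2 * (y b ⬝ᵥ B i *ᵥ z b) := fun b i => by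
    have h1 : (Sum.elim (c • y b) (c⁻¹ • z b) : W ⊕ V → ℝ) ∘ Sum.inl = c • y b := rfl
    have h2 : (Sum.elim (c • y b) (c⁻¹ • z b) : W ⊕ V → ℝ) ∘ Sum.inr = c⁻¹ • z b := rfl
    rw [Matrix.fromBlocks_mulVec, h1, h2, dotProduct_block]
    simp only [Matrix.zero_mulVec, zero_add, add_zero, Sum.elim_comp_inl, Sum.elim_comp_inr]
    rw [Matrix.mulVec_smul, Matrix.mulVec_smul, dotProduct_smul, smul_dotProduct,
      dotProduct_smul, smul_dotProduct, Matrix.mulVec_transpose, dotProduct_comm (z b),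
      ← Matrix.dotProduct_mulVec]
    simp only [smul_eq_mul]
    field_simp
    ring
  simp only [hform, Fintype.card_sum, Nat.cast_add] at key
  have h2 : ∀ b : ι → Bool, ∑ i, bitSign (b i) * (2 * (y b ⬝ᵥ B i *ᵥ z b)) =
      2 * ∑ i, bitSign (b i) * (y b ⬝ᵥ B i *ᵥ z b) := fun b => by
    rw [Finset.mul_sum]; exact Finset.sum_congr rfl fun _ _ => by ring
  simp only [h2, ← Finset.mul_sum] at key
  nlinarith [key]

end Khintchine

/-! ### Adaptive query trees and Walsh characters. -/

namespace QueryAlgorithm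

/-- The depth of a query tree. -/
def depth {n : ℕ} : QueryAlgorithm n → ℕ
  | output _ => 0
  | query _ next => max (depth (next true)) (depth (next false)) + 1

/-- An algorithm that makes at most `q` queries on every oracle consistent with `ρ` agrees on these
oracles with a query tree of depth at most `q`. -/
lemma exists_depth_le {n : ℕ} (A : QueryAlgorithm n) (ρ : Fin n → Option Bool) (q : ℕ)
    (h : ∀ y : Fin n → Bool, (∀ v a, ρ v = some a → y v = a) → A.queryCount y ≤ q) :
    ∃ A' : QueryAlgorithm n, A'.depth ≤ q ∧
      ∀ y : Fin n → Bool, (∀ v a, ρ v = some a → y v = a) → A'.run y = A.run y := by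
  induction A generalizing ρ q with
  | output a => exact ⟨output a, Nat.zero_le _, fun _ _ => rfl⟩
  | query v next ih =>
    -- A repeated query has a known answer, so its node is skipped. Thus branches that no oracle can
    -- reach, which `queryCount` does not control, disappear from the tree.
    rcases hv : ρ v with _ | a
    · have hq : 1 ≤ q := by
        have := h (fun v => (ρ v).getD false) (fun v a hva => by simp [hva])
        simp only [queryCount] at this
        omega
      have key : ∀ a : Bool, ∃ A' : QueryAlgorithm n, A'.depth ≤ q - 1 ∧
          ∀ y : Fin n → Bool, (∀ u c, ρ u = some c → y u = c) → y v = a →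
            A'.run y = (next a).run y := fun a => by
        obtain ⟨A', hd, hr⟩ := ih a (Function.update ρ v (some a)) (q - 1) (fun y hy => by
          have hva : y v = a := hy v a (by simp)
          have := h y (fun u c huc => by
            by_cases huv : u = v
            · subst huv; simp [hv] at huc
            · exact hy u c (by simp [huv, huc]))
          simp only [queryCount, hva] at this
          omega)
        refine ⟨A', hd, fun y hy hva => hr y fun u c huc => ?_⟩
        by_cases huv : u = v
        · subst huv
          simp only [Function.update_self, Option.some.injEq] at huc
          rw [hva, huc]
        · rw [Function.update_of_ne huv] at huc
          exact hy u c huc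
      choose N hN1 hN2 using key
      refine ⟨query v N, ?_, fun y hy => ?_⟩
      · simp only [depth]
        have := hN1 true
        have := hN1 false
        omega
      · simp only [run]
        exact hN2 _ y hy rfl
    · obtain ⟨A', hd, hr⟩ := ih a ρ q (fun y hy => by
        have := h y hy
        simp only [queryCount, hy v a hv] at this
        omega)
      refine ⟨A', hd, fun y hy => ?_⟩
      simp only [run, hy v a hv]
      exact hr y hy

/-- A query tree that correlates with `g` has a Walsh character supported on unerased coordinates
that correlates with `g`. -/
lemma abs_sum_run_le {n : ℕ} {β : Type*} [Fintype β] (g : β → ℝ) (Y : β → Fin n → Bool)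
    (W : Finset (Fin n)) (hW : ∀ b, ∀ v ∈ W, Y b v = false) (q : ℕ) {η : ℝ}
    (H : ∀ T : Finset (Fin n), Disjoint T W → T.card ≤ q → |∑ b, g b * walsh T (Y b)| ≤ η)
    (A : QueryAlgorithm n) (T : Finset (Fin n)) (hT : Disjoint T W) (hq : T.card + A.depth ≤ q) :
    |∑ b, g b * walsh T (Y b) * bitSign (A.run (Y b))| ≤ 2 ^ A.depth * η := by
  have hη : 0 ≤ η := (abs_nonneg _).trans (H ∅ (Finset.disjoint_empty_left _) (Nat.zero_le _))
  induction A generalizing T with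
  | output a =>
    simp only [run, ← Finset.sum_mul, abs_mul, abs_bitSign, mul_one, depth, pow_zero, one_mul]
    exact H T hT (by omega)
  | query v next ih =>
    simp only [depth] at hq ⊢
    have hd : ∀ a, (next a).depth ≤ max (next true).depth (next false).depth := by
      intro a; cases a <;> simp
    have hpow : ∀ a, (2 : ℝ) ^ (next a).depth ≤
        2 ^ max (next true).depth (next false).depth := fun a =>
      pow_le_pow_right₀ (by norm_num) (hd a)
    by_cases hv : v ∈ W
    · have h1 := ih false T hT (by have := hd false; omega)
      simp only [run, hW _ v hv]
      refine h1.trans (mul_le_mul_of_nonneg_right ((hpow false).trans ?_) hη)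
      exact pow_le_pow_right₀ (by norm_num) (Nat.le_succ _)
    · have hT' : Disjoint (symmDiff T {v}) W := by
        rw [Finset.disjoint_left] at hT ⊢
        intro u hu
        rw [Finset.mem_symmDiff, Finset.mem_singleton] at hu
        rcases hu with hu | hu
        · exact hT hu.1
        · rw [hu.1]; exact hv
      have hcard : (symmDiff T {v}).card ≤ T.card + 1 := by
        refine (Finset.card_le_card (t := insert v T) ?_).trans (Finset.card_insert_le _ _)
        intro u hu
        rw [Finset.mem_symmDiff, Finset.mem_singleton] at hu
        rw [Finset.mem_insert]
        tauto
      have b1 : ∀ a, |∑ b, g b * walsh T (Y b) * bitSign ((next a).run (Y b))| ≤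
          2 ^ max (next true).depth (next false).depth * η := fun a =>
        (ih a T hT (by have := hd a; omega)).trans (mul_le_mul_of_nonneg_right (hpow a) hη)
      have b2 : ∀ a, |∑ b, g b * walsh (symmDiff T {v}) (Y b) * bitSign ((next a).run (Y b))| ≤
          2 ^ max (next true).depth (next false).depth * η := fun a =>
        (ih a _ hT' (by have := hd a; omega)).trans (mul_le_mul_of_nonneg_right (hpow a) hη)
      -- With `χ` the sign of the answer, the output sign is `(1 + χ)/2` times that of the `false`
      -- branch plus `(1 - χ)/2` times that of the `true` branch. These four halves account for the
      -- factor 2 per level.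
      have e : ∑ b, g b * walsh T (Y b) * bitSign ((query v next).run (Y b)) =
          (∑ b, g b * walsh T (Y b) * bitSign ((next true).run (Y b)) +
           ∑ b, g b * walsh T (Y b) * bitSign ((next false).run (Y b)) -
           ∑ b, g b * walsh (symmDiff T {v}) (Y b) * bitSign ((next true).run (Y b)) +
           ∑ b, g b * walsh (symmDiff T {v}) (Y b) * bitSign ((next false).run (Y b))) / 2 := by
        rw [← Finset.sum_add_distrib, ← Finset.sum_sub_distrib, ← Finset.sum_add_distrib,
          Finset.sum_div]
        refine Finset.sum_congr rfl fun b _ => ?_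
        rw [walsh_symmDiff_singleton]
        simp only [run]
        have ht : bitSign true = -1 := by simp [bitSign]
        have hf : bitSign false = 1 := by simp [bitSign]
        cases h : Y b v <;> simp only [ht, hf] <;> ring
      have t1 := abs_le.1 (b1 true)
      have t2 := abs_le.1 (b1 false)
      have t3 := abs_le.1 (b2 true)
      have t4 := abs_le.1 (b2 false)
      rw [e, pow_succ, abs_le]
      constructor <;> linarith [t1.1, t1.2, t2.1, t2.2, t3.1, t3.2, t4.1, t4.2]

end QueryAlgorithm

/-- The total success probability is an average over the coins of the success counts of
deterministic algorithms. -/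
lemma PMF.exists_le_sum_of_le_sum_map {α β : Type*} [Fintype β] (p : PMF α) (f : β → α → Bool)
    (a : β → Bool) {c : ℝ} (hc : 0 ≤ c)
    (h : ∀ A ∈ p.support, (∑ b, if f b A = a b then (1 : ℝ) else 0) ≤ c) :
    ∑ b, ((p.map (f b)) (a b)).toReal ≤ c := by
  have h0 : ∀ b, (p.map (f b)) (a b) ≠ ⊤ := fun b => PMF.apply_ne_top _ _
  rw [← ENNReal.toReal_sum fun b _ => h0 b]
  refine ENNReal.toReal_le_of_le_ofReal hc ?_
  have h1 : ∀ b, (p.map (f b)) (a b) = ∑' A, p A * (if f b A = a b then 1 else 0) := fun b => by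
    rw [PMF.map_apply]
    refine tsum_congr fun A => ?_
    by_cases hA : f b A = a b
    · simp [hA]
    · simp [hA, Ne.symm hA]
  simp only [h1]
  rw [← Summable.tsum_finsetSum fun _ _ => ENNReal.summable]
  calc ∑' A, ∑ b, p A * (if f b A = a b then 1 else 0)
      ≤ ∑' A, p A * ENNReal.ofReal c := by
        refine ENNReal.tsum_le_tsum fun A => ?_
        rw [← Finset.mul_sum]
        by_cases hA : A ∈ p.support
        · refine mul_le_mul_right ?_ _
          have h2 := ENNReal.ofReal_le_ofReal (h A hA)
          rw [ENNReal.ofReal_sum_of_nonneg (fun b _ => by split_ifs <;> norm_num)] at h2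
          refine le_trans (le_of_eq (Finset.sum_congr rfl fun b _ => ?_)) h2
          split_ifs <;> simp
        · rw [PMF.mem_support_iff, not_not] at hA
          simp [hA]
    _ = ENNReal.ofReal c := by rw [ENNReal.tsum_mul_right, p.tsum_coe, one_mul]

/-! ### From decoders to matchings of correlated parities. -/

namespace IsLocallyDecodable

variable {k n q : ℕ} {δ ε : ℝ} {C : (Fin k → Bool) → (Fin n → Bool)}

/-- On a common codeword, two different values of the same message bit would both be output with
probability above one half. -/
lemma injective (hC : IsLocallyDecodable q δ ε C) (hδ : 0 < δ) (hε : 0 < ε) :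
    Function.Injective C := by
  obtain ⟨dec, -, hdec⟩ := hC
  intro b b' hbb
  by_contra hne
  obtain ⟨i, hi⟩ := Function.ne_iff.1 hne
  have h0 : ∀ c, (hammingDist (C b) (C c) : ℝ) ≤ δ * n ∨ C b ≠ C c := fun c => by
    by_cases h : C b = C c
    · left; rw [h, hammingDist_self]; simp; positivity
    · exact Or.inr h
  have h1 := hdec b i (C b) ((h0 b).resolve_right (by simp))
  have h2 := hdec b' i (C b) ((h0 b').resolve_right (by simp [hbb]))
  have h3 : ((dec i).map fun A => A.run (C b)) (b i) +
      ((dec i).map fun A => A.run (C b)) (b' i) ≤ 1 := by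
    rw [← PMF.tsum_coe ((dec i).map fun A => A.run (C b)), tsum_bool]
    revert hi
    cases b i <;> cases b' i <;> simp [add_comm]
  have h4 := ENNReal.toReal_mono ENNReal.one_ne_top h3
  rw [ENNReal.toReal_add (PMF.apply_ne_top _ _) (PMF.apply_ne_top _ _), ENNReal.toReal_one] at h4
  linarith

lemma le_length (hC : IsLocallyDecodable q δ ε C) (hδ : 0 < δ) (hε : 0 < ε) : k ≤ n := by
  have := Fintype.card_le_of_injective C (hC.injective hδ hε)
  simp only [Fintype.card_pi, Fintype.card_bool, Finset.prod_const, Finset.card_univ,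
    Fintype.card_fin] at this
  exact (Nat.pow_le_pow_iff_right (by norm_num)).1 this

lemma le_one (hC : IsLocallyDecodable q δ ε C) (hδ : 0 < δ) (i : Fin k) : ε ≤ 1 := by
  obtain ⟨dec, -, hdec⟩ := hC
  have h1 := hdec (fun _ => false) i (C fun _ => false)
    (by rw [hammingDist_self]; simp; positivity)
  have h2 := ENNReal.toReal_mono ENNReal.one_ne_top
    (PMF.coe_le_one ((dec i).map fun A => A.run (C fun _ => false)) false)
  rw [ENNReal.toReal_one] at h2
  linarith

/-- Every message bit of a locally decodable code has a large matching of sets of at most three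
codeword coordinates whose parities are correlated with it. -/
theorem exists_matching (hC : IsLocallyDecodable 3 δ ε C) (hε : 0 < ε) (i : Fin k) :
    ∃ F : Finset (Finset (Fin n)),
      (∀ T ∈ F, T.Nonempty ∧ T.card ≤ 3 ∧
        2 ^ k * (ε / 8) ≤ |∑ b : Fin k → Bool, bitSign (b i) * walsh T (C b)|) ∧
      (F : Set (Finset (Fin n))).PairwiseDisjoint id ∧ δ * n ≤ 3 * F.card := by
  classical
  set good : Finset (Fin n) → Prop := fun T => T.Nonempty ∧ T.card ≤ 3 ∧
    2 ^ k * (ε / 8) ≤ |∑ b : Fin k → Bool, bitSign (b i) * walsh T (C b)|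
  -- If a maximal disjoint family were too small, erasing its union `W` would keep the word within
  -- the decoding radius, while no correlated parity would survive outside `W`.
  obtain ⟨F, hF, hmax⟩ := Finset.exists_max_image
    (univ.filter fun F : Finset (Finset (Fin n)) =>
      (∀ T ∈ F, good T) ∧ (F : Set (Finset (Fin n))).PairwiseDisjoint id)
    Finset.card ⟨∅, by simp⟩
  rw [Finset.mem_filter] at hF
  refine ⟨F, hF.2.1, hF.2.2, ?_⟩
  by_contra hlt
  rw [not_le] at hlt
  set W : Finset (Fin n) := F.biUnion id with hWdef
  have hWcard : W.card ≤ 3 * F.card := by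
    rw [mul_comm]
    exact Finset.card_biUnion_le_card_mul _ _ _ fun T hT => (hF.2.1 T hT).2.1
  set Y : (Fin k → Bool) → Fin n → Bool := fun b v => if v ∈ W then false else C b v with hY
  have hdist : ∀ b, (hammingDist (Y b) (C b) : ℝ) ≤ δ * n := fun b => by
    have h1 : hammingDist (Y b) (C b) ≤ W.card := by
      rw [hammingDist]
      refine Finset.card_le_card fun v hv => ?_
      rw [Finset.mem_filter] at hv
      by_contra hvW
      exact hv.2 (by simp [hY, hvW])
    have h2 : ((hammingDist (Y b) (C b) : ℕ) : ℝ) ≤ ((3 * F.card : ℕ) : ℝ) := by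
      exact_mod_cast h1.trans hWcard
    push_cast at h2
    linarith
  have hk : (0 : ℝ) < 2 ^ k := by positivity
  have H : ∀ T : Finset (Fin n), Disjoint T W → T.card ≤ 3 →
      |∑ b : Fin k → Bool, bitSign (b i) * walsh T (Y b)| ≤ 2 ^ k * (ε / 8) := by
    intro T hT hT3
    rcases T.eq_empty_or_nonempty with rfl | hne
    · have h1 := sum_walsh ({i} : Finset (Fin k))
      rw [if_neg (Finset.singleton_ne_empty i)] at h1
      simp only [walsh, Finset.prod_singleton] at h1
      simp only [walsh, Finset.prod_empty, mul_one, h1, abs_zero]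
      positivity
    · have h1 : ∀ b, walsh T (Y b) = walsh T (C b) := fun b => by
        refine Finset.prod_congr rfl fun v hv => ?_
        simp [hY, Finset.disjoint_left.1 hT hv]
      simp only [h1]
      by_contra hbig
      rw [not_le] at hbig
      have hTF : T ∉ F := fun h => by
        obtain ⟨v, hv⟩ := hne
        exact Finset.disjoint_left.1 hT hv (Finset.mem_biUnion.2 ⟨T, h, hv⟩)
      have h2 := hmax (insert T F) (by
        rw [Finset.mem_filter]
        refine ⟨Finset.mem_univ _, ?_, ?_⟩
        · intro T' hT'
          rcases Finset.mem_insert.1 hT' with rfl | h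
          · exact ⟨hne, hT3, hbig.le⟩
          · exact hF.2.1 T' h
        · rw [Finset.coe_insert]
          refine hF.2.2.insert fun T' hT' _ => ?_
          exact (Finset.disjoint_biUnion_right _ _ _).1 hT T' hT')
      rw [Finset.card_insert_of_notMem hTF] at h2
      omega
  obtain ⟨dec, hq, hdec⟩ := hC
  -- A depth-3 tree has correlation at most `2³ · ε / 8 = ε`, so its success rate is at most `1/2 +
  -- ε/2`, below the guaranteed `1/2 + ε`.
  have hsum := PMF.exists_le_sum_of_le_sum_map (dec i) (fun b A => A.run (Y b)) (fun b => b i)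
    (c := 2 ^ k * (1 / 2 + ε / 2)) (by positivity) (fun A hA => by
      obtain ⟨A', hd, hr⟩ := A.exists_depth_le (fun _ => none) 3 (fun y _ => hq i A hA y)
      have h1 := QueryAlgorithm.abs_sum_run_le (fun b : Fin k → Bool => bitSign (b i)) Y W
        (fun b v hv => by simp [hY, hv]) 3 H A' ∅ (Finset.disjoint_empty_left _) (by simpa using hd)
      have h2 : (2 : ℝ) ^ A'.depth ≤ 8 := by
        calc (2 : ℝ) ^ A'.depth ≤ 2 ^ 3 := pow_le_pow_right₀ (by norm_num) hd
          _ = 8 := by norm_num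
      have h3 : ∀ b : Fin k → Bool, (if A.run (Y b) = b i then (1 : ℝ) else 0) =
          1 / 2 + (bitSign (b i) * walsh ∅ (Y b) * bitSign (A'.run (Y b))) / 2 := fun b => by
        rw [hr (Y b) (by simp)]
        cases A.run (Y b) <;> cases b i <;> norm_num [bitSign, walsh]
      simp only [h3]
      rw [Finset.sum_add_distrib, ← Finset.sum_div _ (fun b : Fin k → Bool =>
        bitSign (b i) * walsh ∅ (Y b) * bitSign (A'.run (Y b)))]
      have h4 := (le_abs_self _).trans h1
      have h5 : (2 : ℝ) ^ A'.depth * (2 ^ k * (ε / 8)) ≤ 8 * (2 ^ k * (ε / 8)) := by gcongr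
      simp only [Finset.sum_const, Finset.card_univ, Fintype.card_pi, Fintype.card_bool,
        Finset.prod_const, Fintype.card_fin, nsmul_eq_mul, Nat.cast_pow, Nat.cast_ofNat]
      linarith)
  have hlow : ∑ _b : Fin k → Bool, (1 / 2 + ε) ≤
      ∑ b, ((PMF.map (fun A : QueryAlgorithm n => A.run (Y b)) (dec i)) (b i)).toReal :=
    Finset.sum_le_sum fun b _ => hdec b i (Y b) (hdist b)
  simp only [Finset.sum_const, Finset.card_univ, Fintype.card_pi, Fintype.card_bool,
    Finset.prod_const, Fintype.card_fin, nsmul_eq_mul, Nat.cast_pow, Nat.cast_ofNat] at hlow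
  nlinarith [hlow.trans hsum, mul_pos hk hε]

end IsLocallyDecodable

/-! ### The normal form: matchings of triples with a distinguished first coordinate. -/

/-- The signs of a word, padded with two blocks of constants. -/
noncomputable def paddedSign {n : ℕ} (x : Fin n → Bool) (p : Fin n × Fin 3) : ℝ :=
  if p.2 = 0 then bitSign (x p.1) else 1

lemma paddedSign_mul_self {n : ℕ} (x : Fin n → Bool) (p : Fin n × Fin 3) :
    paddedSign x p * paddedSign x p = 1 := by
  unfold paddedSign
  split_ifs
  · exact bitSign_mul_self _
  · simp

/-- Missing vertices of a small set are filled with constants placed over `u`, an element of the set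
itself, so that disjoint sets still give disjoint triples. The two constant blocks keep the two
vertices distinct. -/
lemma exists_padded_triple {n : ℕ} (T : Finset (Fin n)) (h0 : T.Nonempty) (h3 : T.card ≤ 3) :
    ∃ (u : Fin n) (v : Bool → Fin n × Fin 3), u ∈ T ∧ (∀ c, (v c).1 ∈ T) ∧
      Function.Injective v ∧ ∀ x : Fin n → Bool,
        bitSign (x u) * paddedSign x (v false) * paddedSign x (v true) = walsh T x := by
  have hpos := Finset.card_pos.2 h0
  have hcases : T.card = 1 ∨ T.card = 2 ∨ T.card = 3 := by omega
  have hinj : ∀ p r : Fin n × Fin 3, p ≠ r →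
      Function.Injective fun c : Bool => if c then p else r := by
    intro p r hpr c c' hc
    cases c <;> cases c' <;> simp_all [eq_comm]
  rcases hcases with h | h | h
  · obtain ⟨u, rfl⟩ := Finset.card_eq_one.1 h
    refine ⟨u, fun c => if c then (u, 1) else (u, 2), by simp, ?_, hinj _ _ (by simp), ?_⟩
    · intro c; cases c <;> simp
    · intro x; simp [paddedSign, walsh]
  · obtain ⟨u, v, huv, rfl⟩ := Finset.card_eq_two.1 h
    refine ⟨u, fun c => if c then (u, 1) else (v, 0), by simp, ?_, hinj _ _ (by simp), ?_⟩
    · intro c; cases c <;> simp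
    · intro x; simp [paddedSign, walsh, Finset.prod_pair huv]
  · obtain ⟨u, v, w, huv, huw, hvw, rfl⟩ := Finset.card_eq_three.1 h
    refine ⟨u, fun c => if c then (w, 0) else (v, 0), by simp, ?_,
      hinj _ _ (by simp [Ne.symm hvw]), ?_⟩
    · intro c; cases c <;> simp
    · intro x
      simp [paddedSign, walsh, huv, huw, hvw, mul_assoc]

/-- The normal form of a 3-query locally decodable code: for every message bit a matching of
`m` triples, whose parities are correlated with this bit. -/
theorem IsLocallyDecodable.exists_normalForm {k n : ℕ} {δ ε : ℝ}
    {C : (Fin k → Bool) → (Fin n → Bool)} (hC : IsLocallyDecodable 3 δ ε C) (hε : 0 < ε) :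
    ∃ (m : ℕ) (col : Fin k → Fin m → Fin n) (vtx : Fin k → Fin m × Bool → Fin n × Fin 3)
      (s : Fin k → Fin m → ℝ), δ * n ≤ 3 * m ∧ (∀ i, Function.Injective (col i)) ∧
      (∀ i, Function.Injective (vtx i)) ∧ (∀ i e, |s i e| ≤ 1) ∧
      2 ^ k * (ε / 8 * m * k) ≤ ∑ b : Fin k → Bool, ∑ i, bitSign (b i) * ∑ e, s i e *
        (bitSign (C b (col i e)) * paddedSign (C b) (vtx i (e, false)) *
          paddedSign (C b) (vtx i (e, true))) := by
  classical
  set m : ℕ := ⌈δ * n / 3⌉₊ with hm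
  have key : ∀ i : Fin k, ∃ (T : Fin m → Finset (Fin n)),
      (∀ e, (T e).Nonempty ∧ (T e).card ≤ 3 ∧
        2 ^ k * (ε / 8) ≤ |∑ b : Fin k → Bool, bitSign (b i) * walsh (T e) (C b)|) ∧
      ∀ e e', e ≠ e' → Disjoint (T e) (T e') := fun i => by
    obtain ⟨F, h1, h2, h3⟩ := hC.exists_matching hε i
    have hmF : m ≤ F.card := by
      rw [hm, Nat.ceil_le, div_le_iff₀ (by norm_num)]
      linarith
    obtain ⟨G, hGF, hGm⟩ := Finset.exists_subset_card_eq hmF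
    let f : Fin m ≃ G := (Fintype.equivFinOfCardEq (by simpa using hGm)).symm
    refine ⟨fun e => (f e).1, fun e => h1 _ (hGF (f e).2), fun e e' hne => ?_⟩
    exact h2 (hGF (f e).2) (hGF (f e').2) fun h => hne (f.injective (Subtype.ext h))
  choose T hT hdisj using key
  choose u v hu hv hvinj hw using fun i e =>
    exists_padded_triple (T i e) (hT i e).1 (hT i e).2.1
  have hdet : ∀ i e e' (a : Fin n), a ∈ T i e → a ∈ T i e' → e = e' := fun i e e' a h h' => by
    by_contra hne
    exact Finset.disjoint_left.1 (hdisj i e e' hne) h h'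
  refine ⟨m, u, fun i h => v i h.1 h.2,
    -- The weight is the sign of the correlation, so all triples contribute positively.
    fun i e => SignType.sign (∑ b : Fin k → Bool, bitSign (b i) * walsh (T i e) (C b)),
    ?_, ?_, ?_, ?_, ?_⟩
  · have := Nat.le_ceil (δ * n / 3)
    rw [← hm] at this
    linarith
  · intro i e e' h
    exact hdet i e e' (u i e) (hu i e) (h ▸ hu i e')
  · rintro i ⟨e, c⟩ ⟨e', c'⟩ h
    simp only at h
    have he : e = e' := hdet i e e' (v i e c).1 (hv i e c) (h ▸ hv i e' c')
    subst he
    rw [hvinj i e h]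
  · intro i e
    have habs : ∀ σ : SignType, |(σ : ℝ)| ≤ 1 := fun σ => by cases σ <;> simp
    exact habs _
  · have e1 : ∀ b : Fin k → Bool, ∀ i e, bitSign (C b (u i e)) *
        paddedSign (C b) (v i e false) * paddedSign (C b) (v i e true) =
        walsh (T i e) (C b) := fun b i e => hw i e (C b)
    simp only [e1]
    rw [Finset.sum_comm]
    have e2 : ∀ i : Fin k, 2 ^ k * (ε / 8) * m ≤ ∑ b : Fin k → Bool, bitSign (b i) *
        ∑ e, (SignType.sign (∑ b : Fin k → Bool, bitSign (b i) * walsh (T i e) (C b)) : ℝ) *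
          walsh (T i e) (C b) := fun i => by
      simp only [Finset.mul_sum]
      rw [Finset.sum_comm]
      calc 2 ^ k * (ε / 8) * m = ∑ _e : Fin m, 2 ^ k * (ε / 8) := by simp; ring
        _ ≤ _ := by
          refine Finset.sum_le_sum fun e _ => ?_
          refine (hT i e).2.2.trans (le_of_eq ?_)
          rw [← sign_mul_self (∑ b : Fin k → Bool, bitSign (b i) * walsh (T i e) (C b)),
            Finset.mul_sum]
          exact Finset.sum_congr rfl fun b _ => by ring
    calc 2 ^ k * (ε / 8 * m * k) = ∑ _i : Fin k, 2 ^ k * (ε / 8) * m := by simp; ring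
      _ ≤ _ := Finset.sum_le_sum fun i _ => e2 i

/-! ### Heavy pairs and their negligible contribution. -/

section Codegree

variable {ι U V E : Type*} [Fintype ι] [Fintype E] [DecidableEq U] [DecidableEq V]

/-- The number of triples of the matchings that contain the first coordinate `u` and the other
coordinate `v`. -/
def codegree (col : ι → E → U) (vtx : ι → E × Bool → V) (u : U) (v : V) : ℕ :=
  (univ.filter fun t : ι × E × Bool => col t.1 t.2.1 = u ∧ vtx t.1 t.2 = v).card

/-- A triple is heavy if one of its pairs has large codegree. -/
def IsHeavy (col : ι → E → U) (vtx : ι → E × Bool → V) (d : ℝ) (i : ι) (e : E) : Prop :=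
  ∃ c, d < codegree col vtx (col i e) (vtx i (e, c))

lemma sum_codegree [Fintype U] [Fintype V] (col : ι → E → U) (vtx : ι → E × Bool → V) :
    ∑ p : U × V, codegree col vtx p.1 p.2 = 2 * Fintype.card E * Fintype.card ι := by
  have h := Finset.card_eq_sum_card_fiberwise (s := (univ : Finset (ι × E × Bool)))
    (t := (univ : Finset (U × V))) (f := fun t => (col t.1 t.2.1, vtx t.1 t.2))
    (fun _ _ => Finset.mem_coe.2 (Finset.mem_univ _))
  simp only [Finset.card_univ, Fintype.card_prod, Fintype.card_bool] at h
  rw [mul_comm, mul_comm 2, h]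
  refine Finset.sum_congr rfl fun p _ => ?_
  simp [codegree, Prod.ext_iff]

lemma card_filter_codegree_mul_le [Fintype U] [Fintype V] (col : ι → E → U)
    (vtx : ι → E × Bool → V) (d : ℝ) :
    ((univ.filter fun p : U × V => d < codegree col vtx p.1 p.2).card : ℝ) * d ≤
      2 * Fintype.card E * Fintype.card ι := by
  have h : ((∑ p : U × V, codegree col vtx p.1 p.2 : ℕ) : ℝ) =
      2 * Fintype.card E * Fintype.card ι := by exact_mod_cast sum_codegree col vtx
  rw [← h, ← nsmul_eq_mul, ← Finset.sum_const]
  push_cast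
  calc _ ≤ ∑ p ∈ univ.filter fun p : U × V => d < codegree col vtx p.1 p.2,
        (codegree col vtx p.1 p.2 : ℝ) :=
        Finset.sum_le_sum fun p hp => (Finset.mem_filter.1 hp).2.le
    _ ≤ _ := Finset.sum_le_sum_of_subset_of_nonneg (Finset.filter_subset _ _)
        fun _ _ _ => Nat.cast_nonneg _

open Classical in
/-- The heavy triples cannot be correlated with the message: their contribution is that of a
bipartite 2-query code on pairs and coordinates. -/
theorem sum_heavy_le [DecidableEq ι] [DecidableEq E] [Fintype U] [Fintype V] [Nonempty V]
    [Nonempty ι] [Nonempty E]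
    (col : ι → E → U) (hcol : ∀ i, Function.Injective (col i))
    (vtx : ι → E × Bool → V) (hvtx : ∀ i, Function.Injective (vtx i))
    (s : ι → E → ℝ) (hs : ∀ i e, |s i e| ≤ 1)
    (y : (ι → Bool) → U → ℝ) (hy : ∀ b u, y b u * y b u = 1)
    (x : (ι → Bool) → V → ℝ) (hx : ∀ b v, x b v * x b v = 1) {d : ℝ} (hd : 0 < d) :
    ∑ b : ι → Bool, ∑ i, bitSign (b i) * ∑ e, (if IsHeavy col vtx d i e then s i e else 0) *
        (y b (col i e) * x b (vtx i (e, false)) * x b (vtx i (e, true))) ≤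
      2 ^ Fintype.card ι *
        (√(2 * Fintype.card E * Fintype.card ι / d * Fintype.card V) *
          √(128 * Fintype.card ι *
            (Real.log (Fintype.card U * Fintype.card V + Fintype.card V) + 1))) := by
  have hc : ∀ i e, ∃ c, IsHeavy col vtx d i e →
      d < codegree col vtx (col i e) (vtx i (e, c)) := fun i e => by
    by_cases h : IsHeavy col vtx d i e
    · obtain ⟨c, hc⟩ := h; exact ⟨c, fun _ => hc⟩
    · exact ⟨true, fun h' => absurd h' h⟩
  choose c hc using hc
  -- Each heavy triple becomes one entry, joining its chosen heavy pair to the remaining vertex.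
  -- Injectivity of `col i` bounds the row sums by 1, and injectivity of `vtx i` the column sums.
  set B : ι → Matrix (U × V) V ℝ := fun i p w => ∑ e, if col i e = p.1 ∧
    vtx i (e, c i e) = p.2 ∧ vtx i (e, !c i e) = w then
      (if IsHeavy col vtx d i e then s i e else 0) else 0 with hB
  have hBle : ∀ i p w, |B i p w| ≤ ∑ e, if col i e = p.1 ∧
    vtx i (e, c i e) = p.2 ∧ vtx i (e, !c i e) = w then (1 : ℝ) else 0 := fun i p w => by
    refine (Finset.abs_sum_le_sum_abs _ _).trans (Finset.sum_le_sum fun e _ => ?_)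
    split_ifs
    · exact hs i e
    · simp
    · simp
  have key := sum_bilinearForm_le B
    (fun i p => by
      calc ∑ w, |B i p w| ≤ ∑ w, ∑ e, if col i e = p.1 ∧
            vtx i (e, c i e) = p.2 ∧ vtx i (e, !c i e) = w then (1 : ℝ) else 0 :=
            Finset.sum_le_sum fun w _ => hBle i p w
        _ ≤ ∑ e, if col i e = p.1 then (1 : ℝ) else 0 := by
            rw [Finset.sum_comm]
            refine Finset.sum_le_sum fun e _ => ?_
            by_cases h1 : col i e = p.1
            · by_cases h2 : vtx i (e, c i e) = p.2
              · simp [h1, h2]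
              · simp [h1, h2]
            · simp [h1]
        _ ≤ 1 := by
            rw [Finset.sum_boole]
            exact_mod_cast Finset.card_le_one.2 fun e he e' he' => hcol i (by
              rw [Finset.mem_filter] at he he'
              rw [he.2, he'.2]))
    (fun i w => by
      calc ∑ p, |B i p w| ≤ ∑ p : U × V, ∑ e, if col i e = p.1 ∧
            vtx i (e, c i e) = p.2 ∧ vtx i (e, !c i e) = w then (1 : ℝ) else 0 :=
            Finset.sum_le_sum fun p _ => hBle i p w
        _ ≤ ∑ e, if vtx i (e, !c i e) = w then (1 : ℝ) else 0 := by
            rw [Finset.sum_comm]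
            refine Finset.sum_le_sum fun e _ => ?_
            by_cases h1 : vtx i (e, !c i e) = w
            · simp only [h1, and_true, if_true]
              rw [Finset.sum_eq_single (col i e, vtx i (e, c i e))]
              · simp
              · rintro ⟨u, v⟩ - hne
                rw [if_neg]
                rintro ⟨rfl, rfl⟩
                exact hne rfl
              · simp
            · simp [h1]
        _ ≤ 1 := by
            rw [Finset.sum_boole]
            exact_mod_cast Finset.card_le_one.2 fun e he e' he' => by
              rw [Finset.mem_filter] at he he'
              exact congrArg Prod.fst (hvtx i (he.2.trans he'.2.symm)))
    -- Restricting the vector to heavy pairs is the gain: by counting codegrees, its squared norm is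
    -- at most `2 |E| |ι| / d` instead of `|U| |V|`.
    (fun b p => if d < codegree col vtx p.1 p.2 then y b p.1 * x b p.2 else 0) x
    (Y := 2 * Fintype.card E * Fintype.card ι / d) (Z := Fintype.card V)
    (by
      have h1 : (0 : ℝ) < Fintype.card E := by exact_mod_cast Fintype.card_pos
      have h2 : (0 : ℝ) < Fintype.card ι := by exact_mod_cast Fintype.card_pos
      positivity)
    (by exact_mod_cast Fintype.card_pos)
    (fun b => by
      rw [le_div_iff₀ hd]
      refine le_trans (mul_le_mul_of_nonneg_right (le_of_eq ?_) hd.le)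
        (card_filter_codegree_mul_le col vtx d)
      rw [← Finset.sum_boole]
      refine Finset.sum_congr rfl fun p _ => ?_
      by_cases h : d < codegree col vtx p.1 p.2 <;> simp only [h, if_true, if_false]
      · calc _ = (y b p.1 * y b p.1) * (x b p.2 * x b p.2) := by ring
          _ = 1 := by rw [hy, hx, one_mul]
      · simp)
    (fun b => by simp [dotProduct, hx])
  rw [Fintype.card_prod, Nat.cast_mul] at key
  refine le_trans (le_of_eq ?_) key
  refine Finset.sum_congr rfl fun b _ => Finset.sum_congr rfl fun i _ => ?_
  congr 1
  simp only [dotProduct, Matrix.mulVec, hB, Finset.sum_mul, Finset.mul_sum]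
  have swap : ∀ f : U × V → V → E → ℝ, ∑ p, ∑ w, ∑ e, f p w e = ∑ e, ∑ p, ∑ w, f p w e :=
    fun f => by
      rw [Finset.sum_comm (s := (univ : Finset E))]
      exact Finset.sum_congr rfl fun p _ => Finset.sum_comm
  rw [swap]
  refine Finset.sum_congr rfl fun e _ => ?_
  rw [Finset.sum_eq_single (col i e, vtx i (e, c i e)),
    Finset.sum_eq_single (vtx i (e, !c i e))]
  · by_cases h : IsHeavy col vtx d i e
    · simp only [h, if_true, hc i e h, true_and]
      cases c i e <;> simp <;> ring
    · simp [h]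
  · intro w _ hw
    simp [Ne.symm hw]
  · simp
  · rintro ⟨u, v⟩ - hne
    refine Finset.sum_eq_zero fun w _ => ?_
    have h : ¬ (col i e = u ∧ vtx i (e, c i e) = v ∧ vtx i (e, !c i e) = w) := by
      rintro ⟨rfl, rfl, -⟩
      exact hne rfl
    simp [h]
  · simp

end Codegree

/-! ### Resampling the bits in a set of indices. -/

section Mix

variable {ι : Type*} [Fintype ι] [DecidableEq ι]

/-- The word that agrees with `c` on `L` and with `b` elsewhere. -/
def mixBits (L : Finset ι) (c b : ι → Bool) : ι → Bool := fun i => if i ∈ L then c i else b i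

/-- Exchanging the entries of `b` and `c` on `L` is an involution on pairs of words, so the mixed
word is uniform. -/
lemma sum_sum_mixBits (L : Finset ι) (f : (ι → Bool) → ℝ) :
    ∑ b : ι → Bool, ∑ c : ι → Bool, f (mixBits L c b) = 2 ^ Fintype.card ι * ∑ b, f b := by
  have hinv : Function.Involutive fun p : (ι → Bool) × (ι → Bool) =>
      (mixBits L p.2 p.1, mixBits L p.1 p.2) := fun p => by
    ext i <;> simp only [mixBits] <;> split_ifs <;> rfl
  calc ∑ b : ι → Bool, ∑ c : ι → Bool, f (mixBits L c b)
      = ∑ p : (ι → Bool) × (ι → Bool), f (mixBits L p.2 p.1) := (Fintype.sum_prod_type' _).symm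
    _ = ∑ p : (ι → Bool) × (ι → Bool), f p.1 :=
        Fintype.sum_equiv hinv.toPerm _ _ fun p => rfl
    _ = ∑ b : ι → Bool, ∑ _c : ι → Bool, f b := Fintype.sum_prod_type' fun b _ => f b
    _ = _ := by simp [Finset.mul_sum]

end Mix

/-! ### Khintchine for graphs with pruned degrees. -/

section Pruning

open Matrix

variable {ι Ω τ : Type*} [Fintype ι] [DecidableEq ι] [Fintype Ω] [DecidableEq Ω] [Fintype τ]

open Classical in
/-- A Khintchine inequality for signed sums of weighted graphs in which the states of large degree
are pruned. Each `i` has a family `τ` of reversible partial moves on the states `Ω`. -/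
theorem sum_moves_le [Nonempty Ω] (L : Finset ι) (cond : ι → τ → Ω → Prop)
    (next : ι → τ → Ω → Ω) (flip : τ → τ) (hflip : Function.Involutive flip)
    (hcond : ∀ i t S, cond i t S → cond i (flip t) (next i t S))
    (hnext : ∀ i t S, cond i t S → next i (flip t) (next i t S) = S)
    (w : (ι → Bool) → ι → τ → ℝ) (hwflip : ∀ b i t, w b i (flip t) = w b i t)
    (hwL : ∀ b b' i t, (∀ j ∉ L, b j = b' j) → w b i t = w b' i t)
    (ω : ι → τ → ℝ) (hωflip : ∀ i t, ω i (flip t) = ω i t) (hω : ∀ b i t, |w b i t| ≤ ω i t)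
    (z : (ι → Bool) → Ω → ℝ) (hz : ∀ b S, |z b S| ≤ 1) {D : ℝ} (hD : 0 < D) :
    ∑ b : ι → Bool, ∑ i ∈ L, bitSign (b i) *
        ∑ S, ∑ t, (if cond i t S then w b i t * (z b S * z b (next i t S)) else 0) ≤
      2 ^ Fintype.card ι * (Fintype.card Ω * D *
          √(128 * Fintype.card ι * (Real.log (Fintype.card Ω) + 1)) +
        2 / D * ∑ i, ∑ S, (∑ t, if cond i t S then ω i t else 0) ^ 2) := by
  set deg : ι → Ω → ℝ := fun i S => ∑ t, if cond i t S then ω i t else 0 with hdeg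
  have hω0 : ∀ i t, 0 ≤ ω i t := fun i t => (abs_nonneg _).trans (hω (fun _ => false) i t)
  have hdeg0 : ∀ i S, 0 ≤ deg i S := fun i S => Finset.sum_nonneg fun t _ => by
    split_ifs
    · exact hω0 i t
    · exact le_rfl
  -- Pruning is done for each `i` separately: a state may be kept for one index and dropped for
  -- another.
  set g : ι → Ω → ℝ := fun i S => if deg i S ≤ D then 1 else 0 with hg
  have hg0 : ∀ i S, 0 ≤ g i S := fun i S => by simp only [hg]; split_ifs <;> norm_num
  have hg1 : ∀ i S, g i S ≤ 1 := fun i S => by simp only [hg]; split_ifs <;> norm_num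
  -- reversing all moves
  have hrev : ∀ i (f : Ω → ℝ), ∑ S, ∑ t, (if cond i t S then ω i t * f (next i t S) else 0) =
      ∑ S, ∑ t, (if cond i t S then ω i t * f S else 0) := fun i f => by
    have e1 : ∀ f : Ω → τ → ℝ, ∑ S, ∑ t, (if cond i t S then f S t else 0) =
        ∑ p ∈ univ.filter (fun p : Ω × τ => cond i p.2 p.1), f p.1 p.2 := fun f => by
      rw [Finset.sum_filter, ← Fintype.sum_prod_type']
    rw [e1 fun S t => ω i t * f (next i t S), e1 fun S t => ω i t * f S]
    refine Finset.sum_bij' (fun p _ => (next i p.2 p.1, flip p.2))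
      (fun p _ => (next i p.2 p.1, flip p.2)) ?_ ?_ ?_ ?_ ?_
    · rintro ⟨S, t⟩ h
      simp only [Finset.mem_filter, Finset.mem_univ, true_and] at h ⊢
      exact hcond i t S h
    · rintro ⟨S, t⟩ h
      simp only [Finset.mem_filter, Finset.mem_univ, true_and] at h ⊢
      exact hcond i t S h
    · rintro ⟨S, t⟩ h
      simp only [Finset.mem_filter, Finset.mem_univ, true_and] at h ⊢
      simp [hnext i t S h, hflip t]
    · rintro ⟨S, t⟩ h
      simp only [Finset.mem_filter, Finset.mem_univ, true_and] at h ⊢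
      simp [hnext i t S h, hflip t]
    · rintro ⟨S, t⟩ h
      simp only [hωflip]
  -- the pruned part
  have hprune : ∀ b, ∀ i, |∑ S, ∑ t, (if cond i t S then w b i t * (z b S * z b (next i t S)) *
      (1 - g i S * g i (next i t S)) else 0)| ≤ 2 / D * ∑ S, deg i S ^ 2 := fun b i => by
    have h1 : ∀ S t, |if cond i t S then w b i t * (z b S * z b (next i t S)) *
        (1 - g i S * g i (next i t S)) else 0| ≤
        (if cond i t S then ω i t * (1 - g i S) else 0) +
          (if cond i t S then ω i t * (1 - g i (next i t S)) else 0) := fun S t => by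
      split_ifs with h
      · rw [abs_mul, abs_mul, abs_mul]
        have h2 : |z b S| * |z b (next i t S)| ≤ 1 :=
          mul_le_one₀ (hz _ _) (abs_nonneg _) (hz _ _)
        have h3 : 0 ≤ 1 - g i S * g i (next i t S) := by
          nlinarith [hg0 i S, hg1 i S, hg0 i (next i t S), hg1 i (next i t S)]
        have h4 : 1 - g i S * g i (next i t S) ≤ (1 - g i S) + (1 - g i (next i t S)) := by
          nlinarith [hg0 i S, hg1 i S, hg0 i (next i t S), hg1 i (next i t S)]
        rw [abs_of_nonneg h3, ← mul_add]
        calc _ ≤ ω i t * 1 * (1 - g i S * g i (next i t S)) := by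
              gcongr
              · exact hω0 i t
              · exact hω b i t
          _ ≤ _ := by rw [mul_one]; exact mul_le_mul_of_nonneg_left h4 (hω0 i t)
      · simp
    calc _ ≤ ∑ S, ∑ t, ((if cond i t S then ω i t * (1 - g i S) else 0) +
          (if cond i t S then ω i t * (1 - g i (next i t S)) else 0)) := by
          refine (Finset.abs_sum_le_sum_abs _ _).trans (Finset.sum_le_sum fun S _ => ?_)
          exact (Finset.abs_sum_le_sum_abs _ _).trans (Finset.sum_le_sum fun t _ => h1 S t)
      _ = 2 * ∑ S, deg i S * (1 - g i S) := by
          simp only [Finset.sum_add_distrib]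
          rw [hrev i fun S => 1 - g i S, ← two_mul]
          simp only [hdeg, Finset.sum_mul, ite_mul, zero_mul]
      -- Only states with degree above `D` contribute, and there `deg ≤ deg² / D`.
      _ ≤ 2 * ∑ S, deg i S ^ 2 / D := by
          gcongr with S
          rw [le_div_iff₀ hD]
          simp only [hg]
          split_ifs with h
          · simp; positivity
          · have := hdeg0 i S
            nlinarith [not_le.1 h]
      _ = _ := by rw [← Finset.sum_div]; ring
  -- the main part
  set B : (ι → Bool) → ι → Matrix Ω Ω ℝ := fun b i S T =>
    if i ∈ L then ∑ t, (if cond i t S ∧ next i t S = T then w b i t * (g i S * g i T) else 0)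
      else 0 with hB
  have hBform : ∀ b b' i, i ∈ L → z b ⬝ᵥ B b' i *ᵥ z b =
      ∑ S, ∑ t, (if cond i t S then w b' i t * (z b S * z b (next i t S)) *
        (g i S * g i (next i t S)) else 0) := fun b b' i hi => by
    simp only [dotProduct, Matrix.mulVec, hB, hi, if_true]
    refine Finset.sum_congr rfl fun S _ => ?_
    simp only [Finset.sum_mul, Finset.mul_sum]
    rw [Finset.sum_comm]
    refine Finset.sum_congr rfl fun t _ => ?_
    rw [Finset.sum_eq_single (next i t S)]
    · by_cases h : cond i t S
      · simp only [h, true_and, if_true]; ring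
      · simp [h]
    · intro T _ hT
      simp [Ne.symm hT]
    · simp
  have hBL : ∀ b i, i ∉ L → B b i = 0 := fun b i hi => by
    ext S T; simp [hB, hi]
  have hBsymm : ∀ b i, (B b i).IsSymm := fun b i => by
    ext S T
    rw [Matrix.transpose_apply]
    simp only [hB]
    split_ifs
    · refine Fintype.sum_equiv hflip.toPerm _ _ fun t => ?_
      simp only [Function.Involutive.coe_toPerm, hwflip]
      have : (cond i t T ∧ next i t T = S) ↔ (cond i (flip t) S ∧ next i (flip t) S = T) := by
        constructor
        · rintro ⟨h, rfl⟩
          exact ⟨hcond i t T h, hnext i t T h⟩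
        · rintro ⟨h, rfl⟩
          have h1 := hcond i _ S h
          have h2 := hnext i _ S h
          rw [hflip t] at h1 h2
          exact ⟨h1, h2⟩
      simp only [this, mul_comm (g i T)]
    · rfl
  have hBrow : ∀ b i S, ∑ T, |B b i S T| ≤ D := fun b i S => by
    by_cases hi : i ∈ L
    · have h1 : ∀ T, |B b i S T| ≤ ∑ t, if next i t S = T then
          (if cond i t S then ω i t * g i S else 0) else 0 := fun T => by
        simp only [hB, hi, if_true]
        refine (Finset.abs_sum_le_sum_abs _ _).trans (Finset.sum_le_sum fun t _ => ?_)
        by_cases h2 : cond i t S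
        · by_cases h3 : next i t S = T
          · simp only [h2, h3, and_self, if_true]
            rw [abs_mul, abs_of_nonneg (mul_nonneg (hg0 i S) (hg0 i T))]
            refine mul_le_mul (hω b i t) ?_ (mul_nonneg (hg0 i S) (hg0 i T)) (hω0 i t)
            exact mul_le_of_le_one_right (hg0 i S) (hg1 i T)
          · simp [h3]
        · simp [h2]
      calc ∑ T, |B b i S T| ≤ ∑ T, ∑ t, if next i t S = T then
            (if cond i t S then ω i t * g i S else 0) else 0 :=
            Finset.sum_le_sum fun T _ => h1 T
        _ = deg i S * g i S := by
            rw [Finset.sum_comm]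
            simp only [Finset.sum_ite_eq, Finset.mem_univ, if_true, hdeg, Finset.sum_mul,
              ite_mul, zero_mul]
        _ ≤ D := by
            simp only [hg]
            split_ifs with h
            · simpa using h
            · simpa using hD.le
    · simp [hBL b i hi, hD.le]
  have hmain : ∑ b : ι → Bool, ∑ i ∈ L, bitSign (b i) * (z b ⬝ᵥ B b i *ᵥ z b) ≤
      2 ^ Fintype.card ι * (Fintype.card Ω * D *
          √(128 * Fintype.card ι * (Real.log (Fintype.card Ω) + 1))) := by
    -- Since the matrices depend only on bits outside `L`, resampling the bits in `L` turns them
    -- into fixed matrices with fresh random signs. The vectors still depend on those signs, which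
    -- the Khintchine inequality permits.
    have h1 := sum_sum_mixBits L fun b => ∑ i ∈ L, bitSign (b i) * (z b ⬝ᵥ B b i *ᵥ z b)
    have h2 : ∀ b : ι → Bool, ∑ c : ι → Bool, ∑ i ∈ L, bitSign (mixBits L c b i) *
        (z (mixBits L c b) ⬝ᵥ B (mixBits L c b) i *ᵥ z (mixBits L c b)) ≤
        2 ^ Fintype.card ι * (Fintype.card Ω * D *
          √(128 * Fintype.card ι * (Real.log (Fintype.card Ω) + 1))) := fun b => by
      have h3 := sum_quadraticForm_le (B b) (hBsymm b) hD.le (hBrow b)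
        (fun c => z (mixBits L c b)) (Z := Fintype.card Ω) (Nat.cast_nonneg _) (fun c => by
          calc _ ≤ ∑ _S : Ω, (1 : ℝ) := Finset.sum_le_sum fun S _ => by
                rw [← abs_mul_abs_self]
                exact mul_le_one₀ (hz _ _) (abs_nonneg _) (hz _ _)
            _ = _ := by simp)
      refine le_trans (le_of_eq ?_) h3
      refine Finset.sum_congr rfl fun c _ => ?_
      rw [← Finset.sum_subset (Finset.subset_univ L)
        (fun i _ hi => by rw [hBL b i hi]; simp)]
      refine Finset.sum_congr rfl fun i hi => ?_
      have h4 : B (mixBits L c b) i = B b i := by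
        ext S T
        simp only [hB, hi, if_true]
        refine Finset.sum_congr rfl fun t _ => ?_
        rw [hwL (mixBits L c b) b i t fun j hj => by simp [mixBits, hj]]
      have h5 : mixBits L c b i = c i := by simp [mixBits, hi]
      rw [h4, h5]
    have h3 := Finset.sum_le_sum fun (b : ι → Bool) (_ : b ∈ univ) => h2 b
    rw [h1] at h3
    simp only [Finset.sum_const, Finset.card_univ, Fintype.card_pi, Fintype.card_bool,
      Finset.prod_const, nsmul_eq_mul, Nat.cast_pow, Nat.cast_ofNat] at h3
    exact le_of_mul_le_mul_left h3 (by positivity)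
  have hsplit : ∀ b i, i ∈ L → bitSign (b i) *
      ∑ S, ∑ t, (if cond i t S then w b i t * (z b S * z b (next i t S)) else 0) ≤
      bitSign (b i) * (z b ⬝ᵥ B b i *ᵥ z b) + 2 / D * ∑ S, deg i S ^ 2 := fun b i hi => by
    have h1 : ∑ S, ∑ t, (if cond i t S then w b i t * (z b S * z b (next i t S)) else 0) =
        z b ⬝ᵥ B b i *ᵥ z b + ∑ S, ∑ t, (if cond i t S then
          w b i t * (z b S * z b (next i t S)) * (1 - g i S * g i (next i t S)) else 0) := by
      rw [hBform b b i hi, ← Finset.sum_add_distrib]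
      refine Finset.sum_congr rfl fun S _ => ?_
      rw [← Finset.sum_add_distrib]
      refine Finset.sum_congr rfl fun t _ => ?_
      split_ifs <;> ring
    rw [h1, mul_add]
    refine add_le_add le_rfl ((le_abs_self _).trans ?_)
    rw [abs_mul, abs_bitSign, one_mul]
    exact hprune b i
  calc _ ≤ ∑ b : ι → Bool, ∑ i ∈ L, (bitSign (b i) * (z b ⬝ᵥ B b i *ᵥ z b) +
        2 / D * ∑ S, deg i S ^ 2) :=
        Finset.sum_le_sum fun b _ => Finset.sum_le_sum fun i hi => hsplit b i hi
    _ = ∑ b : ι → Bool, ∑ i ∈ L, bitSign (b i) * (z b ⬝ᵥ B b i *ᵥ z b) +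
        2 ^ Fintype.card ι * (2 / D * ∑ i ∈ L, ∑ S, deg i S ^ 2) := by
        simp only [Finset.sum_add_distrib, ← Finset.mul_sum]
        simp
        ring
    _ ≤ _ := by
        rw [mul_add]
        have h9 : ∑ i ∈ L, ∑ S, deg i S ^ 2 ≤ ∑ i, ∑ S, deg i S ^ 2 :=
          Finset.sum_le_sum_of_subset_of_nonneg (Finset.subset_univ L)
            fun i _ _ => Finset.sum_nonneg fun S _ => sq_nonneg _
        refine add_le_add hmain ?_
        gcongr

end Pruning

/-! ### Random sequences of vertices. -/

section Sequences

variable {V : Type*} {ℓ : ℕ}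

/-- The number of positions of the sequence `S` that carry `v`. -/
noncomputable def occurrences [DecidableEq V] (v : V) (S : Fin ℓ → V) : ℝ := ∑ a, if S a = v then 1 else 0

lemma sum_sequences_apply_eq [Fintype V] [DecidableEq V] [Nonempty V] (a : Fin ℓ) (v : V) :
    ∑ S : Fin ℓ → V, (if S a = v then (1 : ℝ) else 0) =
      (Fintype.card V : ℝ) ^ ℓ * (Fintype.card V : ℝ)⁻¹ := by
  have hN : (Fintype.card V : ℝ) ≠ 0 := by exact_mod_cast Fintype.card_ne_zero
  calc ∑ S : Fin ℓ → V, (if S a = v then (1 : ℝ) else 0)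
      = ∑ S : Fin ℓ → V, ∏ c, (if c = a then (if S c = v then (1 : ℝ) else 0) else 1) := by
        refine Finset.sum_congr rfl fun S _ => ?_
        rw [Finset.prod_ite_eq']; simp
    _ = ∏ c : Fin ℓ, ∑ u : V, (if c = a then (if u = v then (1 : ℝ) else 0) else 1) := by
        rw [Finset.prod_univ_sum, Fintype.piFinset_univ]
    _ = ∏ c : Fin ℓ, ((Fintype.card V : ℝ) * if c = a then (Fintype.card V : ℝ)⁻¹ else 1) := by
        refine Finset.prod_congr rfl fun c _ => ?_
        split_ifs
        · simp [hN]
        · simp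
    _ = _ := by
        rw [Finset.prod_mul_distrib, Finset.prod_ite_eq']; simp

lemma sum_sequences_apply_eq_apply_eq [Fintype V] [DecidableEq V] [Nonempty V] {a a' : Fin ℓ} (haa : a ≠ a') (v v' : V) :
    ∑ S : Fin ℓ → V, (if S a = v then (1 : ℝ) else 0) * (if S a' = v' then (1 : ℝ) else 0) =
      (Fintype.card V : ℝ) ^ ℓ * ((Fintype.card V : ℝ)⁻¹ * (Fintype.card V : ℝ)⁻¹) := by
  have hN : (Fintype.card V : ℝ) ≠ 0 := by exact_mod_cast Fintype.card_ne_zero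
  calc ∑ S : Fin ℓ → V, (if S a = v then (1 : ℝ) else 0) * (if S a' = v' then (1 : ℝ) else 0)
      = ∑ S : Fin ℓ → V, ∏ c, ((if c = a then (if S c = v then (1 : ℝ) else 0) else 1) *
          (if c = a' then (if S c = v' then (1 : ℝ) else 0) else 1)) := by
        refine Finset.sum_congr rfl fun S _ => ?_
        rw [Finset.prod_mul_distrib, Finset.prod_ite_eq', Finset.prod_ite_eq']; simp
    _ = ∏ c : Fin ℓ, ∑ u : V, ((if c = a then (if u = v then (1 : ℝ) else 0) else 1) *
          (if c = a' then (if u = v' then (1 : ℝ) else 0) else 1)) := by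
        rw [Finset.prod_univ_sum, Fintype.piFinset_univ]
    _ = ∏ c : Fin ℓ, ((Fintype.card V : ℝ) * ((if c = a then (Fintype.card V : ℝ)⁻¹ else 1) *
          (if c = a' then (Fintype.card V : ℝ)⁻¹ else 1))) := by
        refine Finset.prod_congr rfl fun c _ => ?_
        by_cases h : c = a
        · have h' : c ≠ a' := h ▸ haa
          simp [h, haa, hN]
        · by_cases h' : c = a'
          · simp [h', Ne.symm haa, hN]
          · simp [h, h']
    _ = _ := by
        rw [Finset.prod_mul_distrib, Finset.prod_mul_distrib, Finset.prod_ite_eq',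
          Finset.prod_ite_eq']
        simp

/-- Distinct positions are independent and give the squared mean; equal positions contribute only
when `v = w`. -/
lemma sum_occurrences_mul_occurrences_le [Fintype V] [DecidableEq V] [Nonempty V] (v w : V) :
    ∑ S : Fin ℓ → V, occurrences v S * occurrences w S ≤
      (Fintype.card V : ℝ) ^ ℓ * (((ℓ : ℝ) / Fintype.card V) ^ 2 +
        if v = w then (ℓ : ℝ) / Fintype.card V else 0) := by
  have h1 : ∀ a a' : Fin ℓ, ∑ S : Fin ℓ → V,
      (if S a = v then (1 : ℝ) else 0) * (if S a' = w then (1 : ℝ) else 0) ≤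
      (Fintype.card V : ℝ) ^ ℓ * ((Fintype.card V : ℝ)⁻¹ * (Fintype.card V : ℝ)⁻¹ +
        if a = a' then (if v = w then (Fintype.card V : ℝ)⁻¹ else 0) else 0) := fun a a' => by
    by_cases haa : a = a'
    · subst haa
      by_cases hvw : v = w
      · subst hvw
        simp only [mul_ite, mul_one, mul_zero, if_true]
        have := sum_sequences_apply_eq (ℓ := ℓ) a v
        rw [mul_add, ← this]
        have h0 : (0 : ℝ) ≤ (Fintype.card V : ℝ) ^ ℓ *
          ((Fintype.card V : ℝ)⁻¹ * (Fintype.card V : ℝ)⁻¹) := by positivity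
        refine le_trans (le_of_eq ?_) (le_add_of_nonneg_left h0)
        refine Finset.sum_congr rfl fun S _ => ?_
        split_ifs <;> rfl
      · rw [Finset.sum_eq_zero]
        · positivity
        · intro S _
          by_cases hS : S a = v
          · simp [hS, hvw]
          · simp [hS]
    · rw [sum_sequences_apply_eq_apply_eq haa]
      simp [haa]
  simp only [occurrences, Finset.sum_mul_sum]
  rw [Finset.sum_comm]
  simp only [Finset.sum_comm (s := (univ : Finset (Fin ℓ → V)))]
  calc _ ≤ ∑ a : Fin ℓ, ∑ a' : Fin ℓ, (Fintype.card V : ℝ) ^ ℓ *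
        ((Fintype.card V : ℝ)⁻¹ * (Fintype.card V : ℝ)⁻¹ +
        if a = a' then (if v = w then (Fintype.card V : ℝ)⁻¹ else 0) else 0) :=
        Finset.sum_le_sum fun a _ => Finset.sum_le_sum fun a' _ => h1 a a'
    _ = _ := by
        simp only [← Finset.mul_sum, Finset.sum_add_distrib, Finset.sum_ite_eq, Finset.mem_univ,
          if_true]
        simp only [Finset.sum_const, Finset.card_univ, Fintype.card_fin, nsmul_eq_mul]
        split_ifs <;> ring

/-- Untouched positions cancel because signs square to 1, so a move in the Kikuchi graph reads off
exactly the replaced and the new vertex. Repeated entries in a sequence do no harm. -/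
lemma prod_mul_prod_update (x : V → ℝ) (hx : ∀ v, x v * x v = 1) (S : Fin ℓ → V) (a : Fin ℓ)
    (w : V) :
    (∏ c, x (S c)) * ∏ c, x (Function.update S a w c) = x (S a) * x w := by
  rw [← Finset.prod_mul_distrib, Finset.prod_eq_single a]
  · simp
  · intro c _ hc
    rw [Function.update_of_ne hc, hx]
  · simp

end Sequences

/-! ### Weighted counts of pairs of triples that share a first coordinate. -/

section Kikuchi

variable {ι U V E : Type*} [DecidableEq U]

/-- The other end of a half-edge. -/
def flipEnd (h : E × Bool) : E × Bool := (h.1, !h.2)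

lemma flipEnd_flipEnd (h : E × Bool) : flipEnd (flipEnd h) = h := by
  simp [flipEnd]

/-- The weight of the pair of half-edges `q.2.1` of the `i`-th and `q.2.2` of the `q.1`-th matching:
the triples have to share their first coordinate. -/
noncomputable def pairWeight (col : ι → E → U) (s : ι → E → ℝ) (i : ι)
    (q : ι × (E × Bool) × (E × Bool)) : ℝ :=
  if col i q.2.1.1 = col q.1 q.2.2.1 then s i q.2.1.1 * s q.1 q.2.2.1 else 0

lemma abs_pairWeight_le {col : ι → E → U} {s : ι → E → ℝ} (hs : ∀ i e, |s i e| ≤ 1) (i : ι)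
    (q : ι × (E × Bool) × (E × Bool)) :
    |pairWeight col s i q| ≤ if col i q.2.1.1 = col q.1 q.2.2.1 then 1 else 0 := by
  unfold pairWeight
  split_ifs
  · rw [abs_mul]
    exact mul_le_one₀ (hs _ _) (abs_nonneg _) (hs _ _)
  · simp

lemma sum_half_edges_col_le [Fintype E] {f : E → U} (hf : Function.Injective f) (u : U) :
    ∑ h : E × Bool, (if u = f h.1 then (1 : ℝ) else 0) ≤ 2 := by
  rw [Fintype.sum_prod_type]
  have e : ∀ e : E, ∑ _c : Bool, (if u = f e then (1 : ℝ) else 0) =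
      2 * if u = f e then (1 : ℝ) else 0 := fun e => by simp
  simp only [e]
  rw [← Finset.mul_sum, Finset.sum_boole]
  have h : ((univ.filter fun e => u = f e).card : ℝ) ≤ 1 := by
    exact_mod_cast Finset.card_le_one.2 fun e he e' he' => hf (by
      rw [Finset.mem_filter] at he he'
      rw [← he.2, ← he'.2])
  linarith

lemma sum_ite_injective_le {α β : Type*} [Fintype α] [DecidableEq β] {f : α → β}
    (hf : Function.Injective f) (v : β) (g : α → ℝ) {c : ℝ} (hc : 0 ≤ c) (hg : ∀ h, g h ≤ c) :
    ∑ h, (if v = f h then g h else 0) ≤ c := by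
  classical
  by_cases h : ∃ h, v = f h
  · obtain ⟨h, rfl⟩ := h
    rw [Finset.sum_eq_single h]
    · simpa using hg h
    · intro h' _ hne
      rw [if_neg fun e => hne (hf e.symm)]
    · simp
  · rw [Finset.sum_eq_zero]
    · exact hc
    · intro h' _
      rw [if_neg fun e => h ⟨h', e⟩]

section PairSums

variable [Fintype ι] [Fintype E] {col : ι → E → U} {vtx : ι → E × Bool → V} {s : ι → E → ℝ}

lemma sum_abs_pairWeight_le (hcol : ∀ i, Function.Injective (col i))
    (hs : ∀ i e, |s i e| ≤ 1)
    (i : ι) :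
    ∑ q, |pairWeight col s i q| ≤ 4 * Fintype.card E * Fintype.card ι := by
  calc ∑ q, |pairWeight col s i q|
      ≤ ∑ q : ι × (E × Bool) × (E × Bool), if col i q.2.1.1 = col q.1 q.2.2.1 then (1 : ℝ) else 0 :=
        Finset.sum_le_sum fun q _ => abs_pairWeight_le (col := col) hs i q
    _ = ∑ j : ι, ∑ h : E × Bool, ∑ h' : E × Bool,
          if col i h.1 = col j h'.1 then (1 : ℝ) else 0 := by
        rw [Fintype.sum_prod_type]
        refine Finset.sum_congr rfl fun j _ => ?_
        rw [Fintype.sum_prod_type]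
    _ ≤ ∑ _j : ι, ∑ _h : E × Bool, 2 := Finset.sum_le_sum fun j _ => Finset.sum_le_sum fun h _ =>
        sum_half_edges_col_le (hcol j) _
    _ = _ := by simp; ring

lemma sum_abs_pairWeight_fst_le [DecidableEq V] (hcol : ∀ i, Function.Injective (col i))
    (hvtx : ∀ i, Function.Injective (vtx i))
    (hs : ∀ i e, |s i e| ≤ 1)
    (i : ι) (v : V) :
    ∑ q, (if v = vtx i q.2.1 then |pairWeight col s i q| else 0) ≤ 2 * Fintype.card ι := by
  calc _ ≤ ∑ q : ι × (E × Bool) × (E × Bool), (if v = vtx i q.2.1 then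
          (if col i q.2.1.1 = col q.1 q.2.2.1 then (1 : ℝ) else 0) else 0) :=
        Finset.sum_le_sum fun q _ => by
          split_ifs with h1 h2
          · simpa [h2] using abs_pairWeight_le (col := col) hs i q
          · simpa [h2] using abs_pairWeight_le (col := col) hs i q
          · exact le_rfl
    _ = ∑ j : ι, ∑ h : E × Bool, if v = vtx i h then
          ∑ h' : E × Bool, (if col i h.1 = col j h'.1 then (1 : ℝ) else 0) else 0 := by
        rw [Fintype.sum_prod_type]
        refine Finset.sum_congr rfl fun j _ => ?_
        rw [Fintype.sum_prod_type]
        refine Finset.sum_congr rfl fun h _ => ?_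
        split_ifs <;> simp
    _ ≤ ∑ _j : ι, 2 := Finset.sum_le_sum fun j _ =>
        sum_ite_injective_le (hvtx i) v _ zero_le_two fun h => sum_half_edges_col_le (hcol j) _
    _ = _ := by simp; ring

lemma sum_abs_pairWeight_snd_le [DecidableEq V] (hcol : ∀ i, Function.Injective (col i))
    (hvtx : ∀ i, Function.Injective (vtx i))
    (hs : ∀ i e, |s i e| ≤ 1)
    (i : ι) (v : V) :
    ∑ q, (if v = vtx q.1 q.2.2 then |pairWeight col s i q| else 0) ≤ 2 * Fintype.card ι := by
  calc _ ≤ ∑ q : ι × (E × Bool) × (E × Bool), (if v = vtx q.1 q.2.2 then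
          (if col q.1 q.2.2.1 = col i q.2.1.1 then (1 : ℝ) else 0) else 0) :=
        Finset.sum_le_sum fun q _ => by
          split_ifs with h1 h2
          · simpa [h2] using abs_pairWeight_le (col := col) hs i q
          · simpa [Ne.symm h2] using abs_pairWeight_le (col := col) hs i q
          · exact le_rfl
    _ = ∑ j : ι, ∑ h' : E × Bool, if v = vtx j h' then
          ∑ h : E × Bool, (if col j h'.1 = col i h.1 then (1 : ℝ) else 0) else 0 := by
        rw [Fintype.sum_prod_type]
        refine Finset.sum_congr rfl fun j _ => ?_
        rw [Fintype.sum_prod_type_right]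
        refine Finset.sum_congr rfl fun h _ => ?_
        split_ifs <;> simp
    _ ≤ ∑ _j : ι, 2 := Finset.sum_le_sum fun j _ =>
        sum_ite_injective_le (hvtx j) v _ zero_le_two fun h => sum_half_edges_col_le (hcol i) _
    _ = _ := by simp; ring

/-- The vertex of `h` determines the half-edge in the `i`-th matching and hence the shared first
coordinate; the remaining freedom is a triple through that coordinate and `v`. -/
lemma sum_abs_pairWeight_both_le [DecidableEq E] [DecidableEq V] (hvtx : ∀ i, Function.Injective (vtx i))
    (hs : ∀ i e, |s i e| ≤ 1)
    (i : ι) (h : E × Bool) (v : V) :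
    ∑ q, (if vtx i h = vtx i q.2.1 ∧ v = vtx q.1 q.2.2 then |pairWeight col s i q| else 0) ≤
      codegree col vtx (col i h.1) v := by
  calc _ ≤ ∑ q : ι × (E × Bool) × (E × Bool), (if h = q.2.1 then
          (if col q.1 q.2.2.1 = col i h.1 ∧ vtx q.1 q.2.2 = v then (1 : ℝ) else 0) else 0) :=
        Finset.sum_le_sum fun q _ => by
          split_ifs with h1 h2 h3 h3
          · exact (abs_pairWeight_le (col := col) hs i q).trans (by split_ifs <;> norm_num)
          · have := abs_pairWeight_le (col := col) hs i q
            rw [if_neg] at this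
            · exact this
            · intro h4
              exact h3 ⟨by rw [h2, h4], h1.2.symm⟩
          · exact absurd (hvtx i h1.1) h2
          · exact zero_le_one
          · exact le_rfl
          · exact le_rfl
    _ = ∑ t : ι × E × Bool, (if col t.1 t.2.1 = col i h.1 ∧ vtx t.1 t.2 = v then (1 : ℝ) else 0) := by
        rw [Fintype.sum_prod_type, Fintype.sum_prod_type]
        refine Finset.sum_congr rfl fun j _ => ?_
        rw [Fintype.sum_prod_type_right]
        simp
    _ = _ := by rw [Finset.sum_boole, codegree]

/-- This is the second moment of the Kikuchi degree, up to normalization. The three terms in the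
last factor come from pairs that share no vertex constraint, one, or both; the last case is where
lightness enters, through `d`. -/
lemma sum_sum_pairWeight_mul_le [DecidableEq E] [DecidableEq V] (hcol : ∀ i, Function.Injective (col i))
    (hvtx : ∀ i, Function.Injective (vtx i))
    (hs : ∀ i e, |s i e| ≤ 1)
    {d ρ : ℝ} (hd : 0 ≤ d) (hρ : 0 ≤ ρ)
    (hlight : ∀ i e, s i e ≠ 0 → ∀ c, (codegree col vtx (col i e) (vtx i (e, c)) : ℝ) ≤ d) (i : ι) :
    ∑ q, ∑ q', |pairWeight col s i q| * |pairWeight col s i q'| *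
      ((ρ ^ 2 + if vtx i q.2.1 = vtx i q'.2.1 then ρ else 0) *
        (ρ ^ 2 + if vtx q.1 q.2.2 = vtx q'.1 q'.2.2 then ρ else 0)) ≤
      4 * Fintype.card E * Fintype.card ι * ρ ^ 2 *
        (4 * Fintype.card E * Fintype.card ι * ρ ^ 2 + 4 * Fintype.card ι * ρ + d) := by
  have hinner : ∀ q, |pairWeight col s i q| * ∑ q', |pairWeight col s i q'| *
      ((ρ ^ 2 + if vtx i q.2.1 = vtx i q'.2.1 then ρ else 0) *
        (ρ ^ 2 + if vtx q.1 q.2.2 = vtx q'.1 q'.2.2 then ρ else 0)) ≤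
      |pairWeight col s i q| * (ρ ^ 2 *
        (4 * Fintype.card E * Fintype.card ι * ρ ^ 2 + 4 * Fintype.card ι * ρ + d)) := fun q => by
    by_cases hq : pairWeight col s i q = 0
    · simp [hq]
    refine mul_le_mul_of_nonneg_left ?_ (abs_nonneg _)
    have hq2 : col i q.2.1.1 = col q.1 q.2.2.1 ∧ s q.1 q.2.2.1 ≠ 0 := by
      unfold pairWeight at hq
      split_ifs at hq with h
      · exact ⟨h, right_ne_zero_of_mul hq⟩
      · exact absurd rfl hq
    have e : ∀ q', |pairWeight col s i q'| *
      ((ρ ^ 2 + if vtx i q.2.1 = vtx i q'.2.1 then ρ else 0) *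
        (ρ ^ 2 + if vtx q.1 q.2.2 = vtx q'.1 q'.2.2 then ρ else 0)) =
        ρ ^ 4 * |pairWeight col s i q'| +
        ρ ^ 3 * (if vtx i q.2.1 = vtx i q'.2.1 then |pairWeight col s i q'| else 0) +
        ρ ^ 3 * (if vtx q.1 q.2.2 = vtx q'.1 q'.2.2 then |pairWeight col s i q'| else 0) +
        ρ ^ 2 * (if vtx i q.2.1 = vtx i q'.2.1 ∧ vtx q.1 q.2.2 = vtx q'.1 q'.2.2 then
          |pairWeight col s i q'| else 0) := fun q' => by
      by_cases h1 : vtx i q.2.1 = vtx i q'.2.1 <;>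
        by_cases h2 : vtx q.1 q.2.2 = vtx q'.1 q'.2.2 <;> simp only [h1, h2, if_true, if_false,
          and_self, and_true, and_false] <;> ring
    simp only [e, Finset.sum_add_distrib, ← Finset.mul_sum]
    have t1 := sum_abs_pairWeight_le hcol hs i
    have t2 := sum_abs_pairWeight_fst_le hcol hvtx hs i (vtx i q.2.1)
    have t3 := sum_abs_pairWeight_snd_le hcol hvtx hs i (vtx q.1 q.2.2)
    have t4 : ∑ q', (if vtx i q.2.1 = vtx i q'.2.1 ∧ vtx q.1 q.2.2 = vtx q'.1 q'.2.2 then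
        |pairWeight col s i q'| else 0) ≤ d := by
      refine (sum_abs_pairWeight_both_le hvtx hs i q.2.1 (vtx q.1 q.2.2)).trans ?_
      rw [hq2.1]
      exact hlight q.1 q.2.2.1 hq2.2 q.2.2.2
    calc _ ≤ ρ ^ 4 * (4 * Fintype.card E * Fintype.card ι) + ρ ^ 3 * (2 * Fintype.card ι) +
          ρ ^ 3 * (2 * Fintype.card ι) + ρ ^ 2 * d := by gcongr
      _ = _ := by ring
  calc _ = ∑ q, |pairWeight col s i q| * ∑ q', |pairWeight col s i q'| *
      ((ρ ^ 2 + if vtx i q.2.1 = vtx i q'.2.1 then ρ else 0) *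
        (ρ ^ 2 + if vtx q.1 q.2.2 = vtx q'.1 q'.2.2 then ρ else 0)) := by
        refine Finset.sum_congr rfl fun q _ => ?_
        rw [Finset.mul_sum]
        exact Finset.sum_congr rfl fun q' _ => mul_assoc _ _ _
    _ ≤ ∑ q, |pairWeight col s i q| * (ρ ^ 2 *
        (4 * Fintype.card E * Fintype.card ι * ρ ^ 2 + 4 * Fintype.card ι * ρ + d)) :=
        Finset.sum_le_sum fun q _ => hinner q
    _ ≤ 4 * Fintype.card E * Fintype.card ι * (ρ ^ 2 *
        (4 * Fintype.card E * Fintype.card ι * ρ ^ 2 + 4 * Fintype.card ι * ρ + d)) := by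
        rw [← Finset.sum_mul]
        exact mul_le_mul_of_nonneg_right (sum_abs_pairWeight_le hcol hs i) (by positivity)
    _ = _ := by ring

end PairSums

end Kikuchi

/-! ### The Kikuchi graph on pairs of sequences. -/

section Kikuchi

variable {ι U V E : Type*} [Fintype ι] [DecidableEq ι] [Fintype E] [DecidableEq E]
  [DecidableEq U] [Fintype V] [DecidableEq V]

/-- The signed parity of the two last coordinates of the triple `e` of the `i`-th matching. -/
def pairParity (vtx : ι → E × Bool → V) (s : ι → E → ℝ) (x : V → ℝ) (i : ι) (e : E) : ℝ :=
  s i e * (x (vtx i (e, false)) * x (vtx i (e, true)))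

/-- The correlation of the `i`-th and the `j`-th matching through common first coordinates. -/
def crossParity (col : ι → E → U) (vtx : ι → E × Bool → V) (s : ι → E → ℝ) (x : V → ℝ)
    (i j : ι) : ℝ :=
  ∑ e, ∑ e', if col i e = col j e' then pairParity vtx s x i e * pairParity vtx s x j e' else 0

-- The factor 4 counts the orientations of the two triples.
omit [Fintype ι] [DecidableEq ι] [DecidableEq E] [Fintype V] [DecidableEq V] in
lemma sum_pairWeight_mul (col : ι → E → U) (vtx : ι → E × Bool → V) (s : ι → E → ℝ) (x : V → ℝ)
    (i j : ι) :
    ∑ h : E × Bool, ∑ h' : E × Bool, pairWeight col s i (j, h, h') *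
      ((x (vtx i h) * x (vtx i (flipEnd h))) * (x (vtx j h') * x (vtx j (flipEnd h')))) =
      4 * crossParity col vtx s x i j := by
  have e : ∀ (e : E) (c : Bool) (e' : E) (c' : Bool), pairWeight col s i (j, (e, c), (e', c')) *
      ((x (vtx i (e, c)) * x (vtx i (flipEnd (e, c)))) *
        (x (vtx j (e', c')) * x (vtx j (flipEnd (e', c'))))) =
      if col i e = col j e' then pairParity vtx s x i e * pairParity vtx s x j e' else 0 := by
    intro e c e' c'
    simp only [pairWeight, flipEnd, pairParity]
    split_ifs
    · cases c <;> cases c' <;> simp only [Bool.not_true, Bool.not_false] <;> ring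
    · simp
  simp only [Fintype.sum_prod_type, e, crossParity, Finset.mul_sum]
  refine Finset.sum_congr rfl fun e _ => ?_
  simp only [Fintype.sum_bool, ← Finset.sum_add_distrib]
  exact Finset.sum_congr rfl fun e' _ => by ring

/-- The spectral bound for the pruned Kikuchi graph of pairs of sequences of length `ℓ`. -/
theorem sum_crossParity_le [Nonempty V] (ℓ : ℕ) (L : Finset ι)
    {col : ι → E → U} (hcol : ∀ i, Function.Injective (col i))
    {vtx : ι → E × Bool → V} (hvtx : ∀ i, Function.Injective (vtx i))
    {s : ι → E → ℝ} (hs : ∀ i e, |s i e| ≤ 1) {d ρ D : ℝ} (hd : 0 ≤ d) (hD : 0 < D)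
    (hρ : ρ = ℓ / Fintype.card V)
    (hlight : ∀ i e, s i e ≠ 0 → ∀ c, (codegree col vtx (col i e) (vtx i (e, c)) : ℝ) ≤ d)
    (x : (ι → Bool) → V → ℝ) (hx : ∀ b v, x b v * x b v = 1) :
    ∑ b : ι → Bool, 4 * ρ ^ 2 * ∑ i ∈ L, ∑ j ∈ Lᶜ, bitSign (b i) * bitSign (b j) *
        crossParity col vtx s (x b) i j ≤
      2 ^ Fintype.card ι * (D *
          √(128 * Fintype.card ι * (2 * ℓ * Real.log (Fintype.card V) + 1)) +
        2 / D * (Fintype.card ι * (4 * Fintype.card E * Fintype.card ι * ρ ^ 2 *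
          (4 * Fintype.card E * Fintype.card ι * ρ ^ 2 + 4 * Fintype.card ι * ρ + d)))) := by
  set M : ℝ := (Fintype.card V : ℝ) ^ ℓ with hM
  have hV : (0 : ℝ) < Fintype.card V := by exact_mod_cast Fintype.card_pos
  have hM0 : 0 < M := by positivity
  have hρ0 : 0 ≤ ρ := by rw [hρ]; positivity
  have hx1 : ∀ b v, |x b v| = 1 := fun b v => by
    have := abs_mul_abs_self (x b v)
    rw [hx] at this
    nlinarith [abs_nonneg (x b v)]
  -- A move chooses triples of matchings `i` and `j` with a common first coordinate and one position
  -- in each sequence; it replaces a vertex by the other end of its half-edge, on the `i` side in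
  -- the first sequence and on the `j` side in the second.
  have key := sum_moves_le (Ω := (Fin ℓ → V) × (Fin ℓ → V))
    (τ := (ι × (E × Bool) × (E × Bool)) × (Fin ℓ × Fin ℓ)) L
    (fun i t S => S.1 t.2.1 = vtx i t.1.2.1 ∧ S.2 t.2.2 = vtx t.1.1 t.1.2.2)
    (fun i t S => (Function.update S.1 t.2.1 (vtx i (flipEnd t.1.2.1)),
      Function.update S.2 t.2.2 (vtx t.1.1 (flipEnd t.1.2.2))))
    (fun t => ((t.1.1, flipEnd t.1.2.1, flipEnd t.1.2.2), t.2))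
    (fun t => by simp [flipEnd_flipEnd])
    (fun i t S h => by simp)
    (fun i t S h => by simp [flipEnd_flipEnd, ← h.1, ← h.2])
    -- Setting the weight to zero for `j ∈ L` makes it independent of the bits in `L`.
    (fun b i t => if t.1.1 ∈ L then 0 else bitSign (b t.1.1) * pairWeight col s i t.1)
    (fun b i t => rfl)
    (fun b b' i t h => by
      by_cases ht : t.1.1 ∈ L
      · simp [ht]
      · simp [ht, h _ ht])
    (fun i t => |pairWeight col s i t.1|)
    (fun i t => rfl)
    (fun b i t => by
      split_ifs
      · simp
      · rw [abs_mul, abs_bitSign, one_mul])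
    (fun b S => (∏ a, x b (S.1 a)) * ∏ a, x b (S.2 a))
    (fun b S => by simp [abs_mul, Finset.abs_prod, hx1]) hD
  have hcard : (Fintype.card ((Fin ℓ → V) × (Fin ℓ → V)) : ℝ) = M * M := by
    simp [hM]
  -- For each move, a proportion `|V|⁻²` of the states admits it. With `ℓ²` choices of positions and
  -- four orientations, each cross parity is counted `4 ρ² M²` times.
  have hvalue : ∀ b i, ∑ S : (Fin ℓ → V) × (Fin ℓ → V),
      ∑ t : (ι × (E × Bool) × (E × Bool)) × (Fin ℓ × Fin ℓ),
      (if S.1 t.2.1 = vtx i t.1.2.1 ∧ S.2 t.2.2 = vtx t.1.1 t.1.2.2 then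
        (if t.1.1 ∈ L then 0 else bitSign (b t.1.1) * pairWeight col s i t.1) *
        (((∏ a, x b (S.1 a)) * ∏ a, x b (S.2 a)) *
          ((∏ a, x b (Function.update S.1 t.2.1 (vtx i (flipEnd t.1.2.1)) a)) *
            ∏ a, x b (Function.update S.2 t.2.2 (vtx t.1.1 (flipEnd t.1.2.2)) a))) else 0) =
      M * M * (4 * ρ ^ 2 * ∑ j ∈ Lᶜ, bitSign (b j) * crossParity col vtx s (x b) i j) := by
    intro b i
    have h1 : ∀ (t : (ι × (E × Bool) × (E × Bool)) × (Fin ℓ × Fin ℓ)),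
      ∑ S : (Fin ℓ → V) × (Fin ℓ → V),
      (if S.1 t.2.1 = vtx i t.1.2.1 ∧ S.2 t.2.2 = vtx t.1.1 t.1.2.2 then
        (if t.1.1 ∈ L then 0 else bitSign (b t.1.1) * pairWeight col s i t.1) *
        (((∏ a, x b (S.1 a)) * ∏ a, x b (S.2 a)) *
          ((∏ a, x b (Function.update S.1 t.2.1 (vtx i (flipEnd t.1.2.1)) a)) *
            ∏ a, x b (Function.update S.2 t.2.2 (vtx t.1.1 (flipEnd t.1.2.2)) a))) else 0) =
        (if t.1.1 ∈ L then 0 else bitSign (b t.1.1) * (pairWeight col s i t.1 *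
          ((x b (vtx i t.1.2.1) * x b (vtx i (flipEnd t.1.2.1))) *
            (x b (vtx t.1.1 t.1.2.2) * x b (vtx t.1.1 (flipEnd t.1.2.2)))))) *
        ((M * (Fintype.card V : ℝ)⁻¹) * (M * (Fintype.card V : ℝ)⁻¹)) := by
      intro t
      conv_rhs =>
        rw [hM, ← sum_sequences_apply_eq t.2.1 (vtx i t.1.2.1)]
      conv_rhs =>
        enter [2, 2]
        rw [sum_sequences_apply_eq t.2.1 (vtx i t.1.2.1),
          ← sum_sequences_apply_eq t.2.2 (vtx t.1.1 t.1.2.2)]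
      rw [Finset.sum_mul_sum, ← Fintype.sum_prod_type', Finset.mul_sum]
      refine Finset.sum_congr rfl fun S _ => ?_
      by_cases h1 : S.1 t.2.1 = vtx i t.1.2.1
      · by_cases h2 : S.2 t.2.2 = vtx t.1.1 t.1.2.2
        · have e1 := prod_mul_prod_update (x b) (hx b) S.1 t.2.1 (vtx i (flipEnd t.1.2.1))
          have e2 := prod_mul_prod_update (x b) (hx b) S.2 t.2.2 (vtx t.1.1 (flipEnd t.1.2.2))
          rw [h1] at e1
          rw [h2] at e2
          rw [mul_mul_mul_comm (∏ a, x b (S.1 a)), e1, e2]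
          simp only [h1, h2, and_self, if_true, mul_one]
          split_ifs <;> ring
        · simp [h2]
      · simp [h1]
    rw [Finset.sum_comm]
    simp only [h1]
    rw [← Finset.sum_mul, Fintype.sum_prod_type]
    simp only [Finset.sum_const, Finset.card_univ, Fintype.card_prod, Fintype.card_fin,
      ← Finset.smul_sum]
    rw [Fintype.sum_prod_type]
    have h2 : ∀ j : ι, ∑ hh : (E × Bool) × (E × Bool), (if j ∈ L then 0 else
        bitSign (b j) * (pairWeight col s i (j, hh) *
          ((x b (vtx i hh.1) * x b (vtx i (flipEnd hh.1))) *
            (x b (vtx j hh.2) * x b (vtx j (flipEnd hh.2)))))) =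
        if j ∈ Lᶜ then bitSign (b j) * (4 * crossParity col vtx s (x b) i j) else 0 := fun j => by
      by_cases hj : j ∈ L
      · simp [hj]
      · simp only [hj, if_false, Finset.mem_compl, not_false_eq_true, if_true]
        rw [← Finset.mul_sum, Fintype.sum_prod_type, sum_pairWeight_mul]
    simp only [h2]
    rw [Finset.sum_ite_mem, Finset.univ_inter, nsmul_eq_mul, hρ]
    have h3 : ∑ j ∈ Lᶜ, bitSign (b j) * (4 * crossParity col vtx s (x b) i j) =
        4 * ∑ j ∈ Lᶜ, bitSign (b j) * crossParity col vtx s (x b) i j := by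
      rw [Finset.mul_sum]; exact Finset.sum_congr rfl fun _ _ => by ring
    rw [h3]
    push_cast
    field_simp
  -- The degree of `S` is a weighted sum of products of occurrence counts in the two independent
  -- sequences, so its second moment factors term by term.
  have hmoment : ∀ i, ∑ S : (Fin ℓ → V) × (Fin ℓ → V),
      (∑ t : (ι × (E × Bool) × (E × Bool)) × (Fin ℓ × Fin ℓ),
        if S.1 t.2.1 = vtx i t.1.2.1 ∧ S.2 t.2.2 = vtx t.1.1 t.1.2.2 then
          |pairWeight col s i t.1| else 0) ^ 2 ≤
      M * M * (4 * Fintype.card E * Fintype.card ι * ρ ^ 2 *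
          (4 * Fintype.card E * Fintype.card ι * ρ ^ 2 + 4 * Fintype.card ι * ρ + d)) := by
    intro i
    have h1 : ∀ S : (Fin ℓ → V) × (Fin ℓ → V),
        (∑ t : (ι × (E × Bool) × (E × Bool)) × (Fin ℓ × Fin ℓ),
        if S.1 t.2.1 = vtx i t.1.2.1 ∧ S.2 t.2.2 = vtx t.1.1 t.1.2.2 then
          |pairWeight col s i t.1| else 0) = ∑ q, |pairWeight col s i q| *
          (occurrences (vtx i q.2.1) S.1 * occurrences (vtx q.1 q.2.2) S.2) := fun S => by
      rw [Fintype.sum_prod_type]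
      refine Finset.sum_congr rfl fun q _ => ?_
      rw [occurrences, occurrences, Finset.sum_mul_sum, ← Fintype.sum_prod_type', Finset.mul_sum]
      refine Finset.sum_congr rfl fun a _ => ?_
      by_cases h1 : S.1 a.1 = vtx i q.2.1 <;> by_cases h2 : S.2 a.2 = vtx q.1 q.2.2 <;>
        simp [h1, h2]
    have h2 : ∀ q q' : ι × (E × Bool) × (E × Bool), ∑ S : (Fin ℓ → V) × (Fin ℓ → V),
        (occurrences (vtx i q.2.1) S.1 * occurrences (vtx q.1 q.2.2) S.2) *
        (occurrences (vtx i q'.2.1) S.1 * occurrences (vtx q'.1 q'.2.2) S.2) ≤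
        M * M * ((ρ ^ 2 + if vtx i q.2.1 = vtx i q'.2.1 then ρ else 0) *
        (ρ ^ 2 + if vtx q.1 q.2.2 = vtx q'.1 q'.2.2 then ρ else 0)) := fun q q' => by
      have h3 := sum_occurrences_mul_occurrences_le (ℓ := ℓ) (vtx i q.2.1) (vtx i q'.2.1)
      have h4 := sum_occurrences_mul_occurrences_le (ℓ := ℓ) (vtx q.1 q.2.2) (vtx q'.1 q'.2.2)
      rw [← hM, ← hρ] at h3 h4
      have hocc : ∀ (v : V) (S : Fin ℓ → V), 0 ≤ occurrences v S := fun v S =>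
        Finset.sum_nonneg fun a _ => by split_ifs <;> norm_num
      calc _ = (∑ S : Fin ℓ → V, occurrences (vtx i q.2.1) S * occurrences (vtx i q'.2.1) S) *
            ∑ S : Fin ℓ → V, occurrences (vtx q.1 q.2.2) S * occurrences (vtx q'.1 q'.2.2) S := by
            rw [Finset.sum_mul_sum, ← Fintype.sum_prod_type']
            exact Finset.sum_congr rfl fun S _ => by ring
        _ ≤ _ := mul_le_mul h3 h4 (Finset.sum_nonneg fun S _ => mul_nonneg (hocc _ _) (hocc _ _))
            (mul_nonneg hM0.le (add_nonneg (sq_nonneg _) (by split_ifs <;> simp [hρ0])))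
        _ = _ := by ring
    calc _ = ∑ q, ∑ q', |pairWeight col s i q| * |pairWeight col s i q'| *
          ∑ S : (Fin ℓ → V) × (Fin ℓ → V),
        (occurrences (vtx i q.2.1) S.1 * occurrences (vtx q.1 q.2.2) S.2) *
        (occurrences (vtx i q'.2.1) S.1 * occurrences (vtx q'.1 q'.2.2) S.2) := by
          simp only [h1, pow_two, Finset.sum_mul_sum]
          rw [Finset.sum_comm]
          refine Finset.sum_congr rfl fun q _ => ?_
          rw [Finset.sum_comm]
          refine Finset.sum_congr rfl fun q' _ => ?_
          rw [Finset.mul_sum]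
          exact Finset.sum_congr rfl fun S _ => by ring
      _ ≤ ∑ q, ∑ q', |pairWeight col s i q| * |pairWeight col s i q'| * (M * M *
          ((ρ ^ 2 + if vtx i q.2.1 = vtx i q'.2.1 then ρ else 0) *
        (ρ ^ 2 + if vtx q.1 q.2.2 = vtx q'.1 q'.2.2 then ρ else 0))) :=
          Finset.sum_le_sum fun q _ => Finset.sum_le_sum fun q' _ =>
            mul_le_mul_of_nonneg_left (h2 q q') (mul_nonneg (abs_nonneg _) (abs_nonneg _))
      _ = M * M * ∑ q, ∑ q', |pairWeight col s i q| * |pairWeight col s i q'| *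
          ((ρ ^ 2 + if vtx i q.2.1 = vtx i q'.2.1 then ρ else 0) *
        (ρ ^ 2 + if vtx q.1 q.2.2 = vtx q'.1 q'.2.2 then ρ else 0)) := by
          simp only [Finset.mul_sum]
          exact Finset.sum_congr rfl fun q _ => Finset.sum_congr rfl fun q' _ => by ring
      _ ≤ _ := mul_le_mul_of_nonneg_left
          (sum_sum_pairWeight_mul_le hcol hvtx hs hd hρ0 hlight i) (by positivity)
  rw [hcard] at key
  have hlog : Real.log (M * M) = 2 * ℓ * Real.log (Fintype.card V) := by
    rw [Real.log_mul hM0.ne' hM0.ne', hM, Real.log_pow]; ring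
  rw [hlog] at key
  have hlhs : ∑ b : ι → Bool, ∑ i ∈ L, bitSign (b i) *
      (M * M * (4 * ρ ^ 2 * ∑ j ∈ Lᶜ, bitSign (b j) * crossParity col vtx s (x b) i j)) =
      M * M * ∑ b : ι → Bool, 4 * ρ ^ 2 * ∑ i ∈ L, ∑ j ∈ Lᶜ, bitSign (b i) * bitSign (b j) *
        crossParity col vtx s (x b) i j := by
    simp only [Finset.mul_sum]
    exact Finset.sum_congr rfl fun b _ => Finset.sum_congr rfl fun i _ =>
      Finset.sum_congr rfl fun j _ => by ring
  refine le_of_mul_le_mul_left ?_ (mul_pos hM0 hM0)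
  rw [← hlhs]
  simp only [← hvalue]
  refine le_trans (le_of_eq ?_) (key.trans ?_)
  · refine Finset.sum_congr rfl fun b _ => Finset.sum_congr rfl fun i _ => ?_
    congr 1
    refine Finset.sum_congr rfl fun S _ => Finset.sum_congr rfl fun t _ => ?_
    split_ifs <;> rfl
  · have h1 := Finset.sum_le_sum fun (i : ι) (_ : i ∈ univ) => hmoment i
    rw [Finset.sum_const, Finset.card_univ, nsmul_eq_mul] at h1
    have h2 : 2 / D * _ ≤ 2 / D * _ := mul_le_mul_of_nonneg_left h1 (by positivity)
    calc _ ≤ (2 : ℝ) ^ Fintype.card ι * (M * M * D *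
          √(128 * Fintype.card ι * (2 * ℓ * Real.log (Fintype.card V) + 1)) +
          2 / D * (Fintype.card ι * (M * M * (4 * Fintype.card E * Fintype.card ι * ρ ^ 2 *
          (4 * Fintype.card E * Fintype.card ι * ρ ^ 2 + 4 * Fintype.card ι * ρ + d))))) := by
          refine mul_le_mul_of_nonneg_left (add_le_add le_rfl ?_) (by positivity)
          refine le_trans (le_of_eq ?_) h2
          congr 1
          refine Finset.sum_congr rfl fun i _ => Finset.sum_congr rfl fun S _ => ?_
          congr 1
          refine Finset.sum_congr rfl fun t _ => ?_
          split_ifs <;> rfl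
      _ = _ := by ring

end Kikuchi

/-! ### Random cuts. -/

section Partition

variable {ι : Type*} [Fintype ι] [DecidableEq ι]

/-- The summand is `(1 - χ_i)(1 + χ_j)`; for `i ≠ j` only its constant term survives summation. -/
lemma sum_cut_indicator (i j : ι) :
    ∑ c : ι → Bool, (if c i = true ∧ c j = false then (4 : ℝ) else 0) =
      if i = j then 0 else 2 ^ Fintype.card ι := by
  split_ifs with hij
  · subst hij
    exact Finset.sum_eq_zero fun c _ => by cases c i <;> simp
  · have h : ∀ c : ι → Bool, (if c i = true ∧ c j = false then (4 : ℝ) else 0) =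
        walsh ∅ c - walsh {i} c + walsh {j} c - walsh {i, j} c := fun c => by
      simp only [walsh, Finset.prod_empty, Finset.prod_singleton, Finset.prod_pair hij]
      cases c i <;> cases c j <;> norm_num [bitSign]
    simp only [h, Finset.sum_add_distrib, Finset.sum_sub_distrib, sum_walsh]
    simp

/-- Some cut of a weighted complete graph captures a quarter of the total weight. -/
lemma exists_cut (a : ι → ι → ℝ) :
    ∃ L : Finset ι, ∑ i, ∑ j, (if i = j then 0 else a i j) ≤ 4 * ∑ i ∈ L, ∑ j ∈ Lᶜ, a i j := by
  by_contra! h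
  have h1 : ∀ c : ι → Bool, 4 * ∑ i ∈ univ.filter (fun i => c i = true),
      ∑ j ∈ (univ.filter fun i => c i = true)ᶜ, a i j =
      ∑ i, ∑ j, (if c i = true ∧ c j = false then (4 : ℝ) else 0) * a i j := fun c => by
    rw [Finset.sum_filter, Finset.mul_sum]
    refine Finset.sum_congr rfl fun i _ => ?_
    rw [Finset.compl_filter, Finset.sum_filter]
    by_cases hi : c i = true
    · simp only [hi, if_true, true_and, Finset.mul_sum, Bool.not_eq_true]
      exact Finset.sum_congr rfl fun j _ => by split_ifs <;> simp
    · simp [hi]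
  have h2 : ∑ c : ι → Bool, ∑ i, ∑ j, (if c i = true ∧ c j = false then (4 : ℝ) else 0) * a i j =
      2 ^ Fintype.card ι * ∑ i, ∑ j, (if i = j then 0 else a i j) := by
    rw [Finset.sum_comm, Finset.mul_sum]
    refine Finset.sum_congr rfl fun i _ => ?_
    rw [Finset.sum_comm, Finset.mul_sum]
    refine Finset.sum_congr rfl fun j _ => ?_
    rw [← Finset.sum_mul, sum_cut_indicator]
    split_ifs <;> simp
  have h3 : ∑ c : ι → Bool, ∑ i, ∑ j, (if c i = true ∧ c j = false then (4 : ℝ) else 0) * a i j <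
      ∑ _c : ι → Bool, ∑ i, ∑ j, (if i = j then 0 else a i j) :=
    Finset.sum_lt_sum_of_nonempty Finset.univ_nonempty fun c _ => by
      rw [← h1 c]; exact h _
  rw [h2] at h3
  simp at h3

end Partition

/-! ### Eliminating the first coordinate. -/

section CauchySchwarz

variable {ι U V E : Type*} [Fintype ι] [DecidableEq ι] [Fintype E] [DecidableEq E]
  [Fintype U] [DecidableEq U] [Fintype V] [DecidableEq V]

-- Group the triples by first coordinate and apply Cauchy-Schwarz: the signs `y` only contribute
-- their squared norm `|U|`.
omit [Fintype V] [DecidableEq V] [DecidableEq ι] [DecidableEq E] in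
lemma sq_sum_triples_le (col : ι → E → U) (vtx : ι → E × Bool → V) (s : ι → E → ℝ) (σ : ι → ℝ)
    (y : U → ℝ) (hy : ∀ u, y u * y u = 1) (x : V → ℝ) :
    (∑ i, σ i * ∑ e, s i e * (y (col i e) * x (vtx i (e, false)) * x (vtx i (e, true)))) ^ 2 ≤
      Fintype.card U * ∑ i, ∑ j, σ i * σ j * crossParity col vtx s x i j := by
  set G : U → ℝ := fun u => ∑ i, ∑ e, if u = col i e then σ i * pairParity vtx s x i e else 0
    with hG
  have h1 : ∑ i, σ i * ∑ e, s i e * (y (col i e) * x (vtx i (e, false)) * x (vtx i (e, true))) =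
      ∑ u, y u * G u := by
    simp only [hG, Finset.mul_sum]
    rw [Finset.sum_comm (s := (univ : Finset U))]
    refine Finset.sum_congr rfl fun i _ => ?_
    rw [Finset.sum_comm]
    refine Finset.sum_congr rfl fun e _ => ?_
    rw [Finset.sum_eq_single (col i e)]
    · simp only [if_true, pairParity]; ring
    · intro u _ hu
      simp [hu]
    · simp
  have h2 : ∑ u, G u ^ 2 = ∑ i, ∑ j, σ i * σ j * crossParity col vtx s x i j := by
    simp only [hG, pow_two, Finset.sum_mul_sum]
    rw [Finset.sum_comm]
    refine Finset.sum_congr rfl fun i _ => ?_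
    rw [Finset.sum_comm]
    refine Finset.sum_congr rfl fun j _ => ?_
    rw [Finset.sum_comm, crossParity, Finset.mul_sum]
    refine Finset.sum_congr rfl fun e _ => ?_
    rw [Finset.sum_comm, Finset.mul_sum]
    refine Finset.sum_congr rfl fun e' _ => ?_
    rw [Finset.sum_eq_single (col i e)]
    · simp only [if_true]
      split_ifs
      · ring
      · simp
    · intro u _ hu
      simp [hu]
    · simp
  rw [h1, ← h2]
  have h3 := Finset.sum_mul_sq_le_sq_mul_sq univ y G
  have h4 : ∑ u, y u ^ 2 = Fintype.card U := by simp [pow_two, hy]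
  rwa [h4] at h3

omit [Fintype ι] [DecidableEq ι] [DecidableEq E] [Fintype U] [Fintype V] [DecidableEq V] in
lemma crossParity_self_le {col : ι → E → U} (hcol : ∀ i, Function.Injective (col i))
    (vtx : ι → E × Bool → V) {s : ι → E → ℝ} (hs : ∀ i e, |s i e| ≤ 1) {x : V → ℝ}
    (hx : ∀ v, x v * x v = 1) (i : ι) : crossParity col vtx s x i i ≤ Fintype.card E := by
  have h : ∀ e, ∑ e', (if col i e = col i e' then pairParity vtx s x i e * pairParity vtx s x i e'
      else 0) ≤ 1 := fun e => by
    classical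
    rw [Finset.sum_eq_single e]
    · simp only [if_true, pairParity]
      calc _ = (s i e * s i e) * ((x (vtx i (e, false)) * x (vtx i (e, false))) *
            (x (vtx i (e, true)) * x (vtx i (e, true)))) := by ring
        _ = |s i e| * |s i e| := by rw [hx, hx, abs_mul_abs_self]; ring
        _ ≤ 1 := mul_le_one₀ (hs i e) (abs_nonneg _) (hs i e)
    · intro e' _ hne
      rw [if_neg fun h => hne (hcol i h.symm)]
    · simp
  calc _ ≤ ∑ _e : E, (1 : ℝ) := Finset.sum_le_sum fun e _ => h e
    _ = _ := by simp

/-- The main inequality: matchings of triples without pairs of large codegree that are correlated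
with the message satisfy a tradeoff, for every length `ℓ` of sequences and every pruning
threshold `D`. -/
theorem light_tradeoff [Nonempty V] [Nonempty U] (ℓ : ℕ)
    {col : ι → E → U} (hcol : ∀ i, Function.Injective (col i))
    {vtx : ι → E × Bool → V} (hvtx : ∀ i, Function.Injective (vtx i))
    {s : ι → E → ℝ} (hs : ∀ i e, |s i e| ≤ 1) {d ρ D : ℝ} (hd : 0 ≤ d) (hD : 0 < D)
    (hρ : ρ = ℓ / Fintype.card V)
    (hlight : ∀ i e, s i e ≠ 0 → ∀ c, (codegree col vtx (col i e) (vtx i (e, c)) : ℝ) ≤ d)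
    (y : (ι → Bool) → U → ℝ) (hy : ∀ b u, y b u * y b u = 1)
    (x : (ι → Bool) → V → ℝ) (hx : ∀ b v, x b v * x b v = 1) {A : ℝ} (hA : 0 ≤ A)
    (hcorr : 2 ^ Fintype.card ι * A ≤ ∑ b : ι → Bool, ∑ i, bitSign (b i) * ∑ e, s i e *
        (y b (col i e) * x b (vtx i (e, false)) * x b (vtx i (e, true)))) :
    ρ ^ 2 * (A ^ 2 / Fintype.card U - Fintype.card ι * Fintype.card E) ≤
      D * √(128 * Fintype.card ι * (2 * ℓ * Real.log (Fintype.card V) + 1)) +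
        2 / D * (Fintype.card ι * (4 * Fintype.card E * Fintype.card ι * ρ ^ 2 *
          (4 * Fintype.card E * Fintype.card ι * ρ ^ 2 + 4 * Fintype.card ι * ρ + d))) := by
  set P : ℝ := 2 ^ Fintype.card ι with hP
  have hP0 : 0 < P := by positivity
  have hU : (0 : ℝ) < Fintype.card U := by exact_mod_cast Fintype.card_pos
  set F : (ι → Bool) → ℝ := fun b => ∑ i, bitSign (b i) * ∑ e, s i e *
        (y b (col i e) * x b (vtx i (e, false)) * x b (vtx i (e, true))) with hF
  set a : ι → ι → ℝ := fun i j => ∑ b : ι → Bool, bitSign (b i) * bitSign (b j) *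
    crossParity col vtx s (x b) i j with ha
  have h1 : (P * A) ^ 2 ≤ P * ∑ b, F b ^ 2 := by
    calc (P * A) ^ 2 ≤ (∑ b, F b) ^ 2 := pow_le_pow_left₀ (by positivity) hcorr 2
      _ ≤ _ := by
        have := sq_sum_le_card_mul_sum_sq (s := (univ : Finset (ι → Bool))) (f := F)
        simpa [hP] using this
  have h2 : ∑ b, F b ^ 2 ≤ Fintype.card U * ∑ i, ∑ j, a i j := by
    calc _ ≤ ∑ b, Fintype.card U * ∑ i, ∑ j, bitSign (b i) * bitSign (b j) *
          crossParity col vtx s (x b) i j := Finset.sum_le_sum fun b _ =>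
          sq_sum_triples_le col vtx s (fun i => bitSign (b i)) (y b) (hy b) (x b)
      _ = _ := by
        rw [← Finset.mul_sum, Finset.sum_comm]
        congr 1
        refine Finset.sum_congr rfl fun i _ => ?_
        rw [Finset.sum_comm]
  -- The diagonal terms `i = j` carry no random sign and are bounded trivially.
  have h3 : ∑ i, ∑ j, a i j ≤ P * (Fintype.card ι * Fintype.card E) +
      ∑ i, ∑ j, (if i = j then 0 else a i j) := by
    have e : ∀ i, ∑ j, a i j = a i i + ∑ j, (if i = j then 0 else a i j) := fun i => by
      have : ∀ j, a i j = (if i = j then a i i else 0) + (if i = j then 0 else a i j) :=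
        fun j => by split_ifs with h <;> simp [h]
      rw [Finset.sum_congr rfl fun j _ => this j, Finset.sum_add_distrib]
      simp
    have hdiag : ∀ i, a i i ≤ P * Fintype.card E := fun i => by
      calc a i i ≤ ∑ _b : ι → Bool, (Fintype.card E : ℝ) := Finset.sum_le_sum fun b _ => by
            rw [bitSign_mul_self, one_mul]
            exact crossParity_self_le hcol vtx hs (hx b) i
        _ = _ := by simp [hP]
    simp only [e, Finset.sum_add_distrib]
    refine add_le_add ?_ le_rfl
    calc _ ≤ ∑ _i : ι, P * (Fintype.card E : ℝ) := Finset.sum_le_sum fun i _ => hdiag i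
      _ = _ := by simp; ring
  obtain ⟨L, hL⟩ := exists_cut a
  have h4 := sum_crossParity_le ℓ L hcol hvtx hs hd hD hρ hlight x hx
  have h5 : ∑ b : ι → Bool, 4 * ρ ^ 2 * ∑ i ∈ L, ∑ j ∈ Lᶜ, bitSign (b i) * bitSign (b j) *
        crossParity col vtx s (x b) i j = ρ ^ 2 * (4 * ∑ i ∈ L, ∑ j ∈ Lᶜ, a i j) := by
    rw [← Finset.mul_sum, Finset.sum_comm, mul_comm 4, mul_assoc]
    congr 2
    refine Finset.sum_congr rfl fun i _ => ?_
    rw [Finset.sum_comm]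
  rw [h5] at h4
  have h6 : P * (A ^ 2 / Fintype.card U - Fintype.card ι * Fintype.card E) ≤
      4 * ∑ i ∈ L, ∑ j ∈ Lᶜ, a i j := by
    have h7 : P * A ^ 2 ≤ Fintype.card U * ∑ i, ∑ j, a i j := by
      refine le_trans ?_ h2
      refine le_of_mul_le_mul_left ?_ hP0
      calc P * (P * A ^ 2) = (P * A) ^ 2 := by ring
        _ ≤ _ := h1
    have h8 : P * (A ^ 2 / Fintype.card U) ≤ ∑ i, ∑ j, a i j := by
      rw [mul_div_assoc', div_le_iff₀ hU]
      linarith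
    linarith
  refine le_of_mul_le_mul_left ?_ hP0
  calc _ = ρ ^ 2 * (P * (A ^ 2 / Fintype.card U - Fintype.card ι * Fintype.card E)) := by ring
    _ ≤ ρ ^ 2 * (4 * ∑ i ∈ L, ∑ j ∈ Lᶜ, a i j) :=
      mul_le_mul_of_nonneg_left h6 (sq_nonneg _)
    _ ≤ _ := h4

end CauchySchwarz

/-! ### Choice of parameters and conclusion. -/

lemma log_three_mul_le {x : ℝ} (hx : 2 ≤ x) : Real.log (3 * x) ≤ 3 * Real.log x := by
  have h1 : 3 * x ≤ x ^ 3 := by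
    have h2 : (2 : ℝ) ^ 2 ≤ x ^ 2 := by gcongr
    calc 3 * x ≤ x ^ 2 * x := by gcongr; linarith
      _ = x ^ 3 := by ring
  calc Real.log (3 * x) ≤ Real.log (x ^ 3) := Real.log_le_log (by positivity) h1
    _ = _ := by rw [Real.log_pow]; norm_num

/-- The optimization over the length `ℓ` and the pruning threshold `D` in `light_tradeoff`. -/
lemma cube_le_of_tradeoff {k n m : ℕ} (hk : 1 ≤ k) (hkn : k ≤ n) (hn : 2 ≤ n) (hm : 1 ≤ m)
    (hmn : m ≤ n) {θ d : ℝ} (hθ : 0 < θ) (hθ1 : θ ≤ 1)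
    (hd : d = 6000 * n * Real.log n / (θ ^ 2 * m))
    (hT : ∀ (ℓ : ℕ) (ρ D : ℝ), 0 < D → ρ = ℓ / (3 * n) →
      ρ ^ 2 * ((θ * m * k) ^ 2 / n - k * m) ≤
        D * √(128 * k * (2 * ℓ * Real.log (3 * n) + 1)) +
          2 / D * (k * (4 * m * k * ρ ^ 2 * (4 * m * k * ρ ^ 2 + 4 * k * ρ + d)))) :
    (k : ℝ) ^ 3 * θ ^ 18 * m ^ 10 ≤
      54000 * (1536 ^ 2 * 1024) ^ 2 * n ^ 11 * Real.log n ^ 3 := by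
  have hk0 : (1 : ℝ) ≤ k := by exact_mod_cast hk
  have hn0 : (2 : ℝ) ≤ n := by exact_mod_cast hn
  have hm0 : (1 : ℝ) ≤ m := by exact_mod_cast hm
  have hkn0 : (k : ℝ) ≤ n := by exact_mod_cast hkn
  have hmn0 : (m : ℝ) ≤ n := by exact_mod_cast hmn
  generalize (k : ℝ) = k at *
  generalize (n : ℝ) = n at *
  generalize (m : ℝ) = m at *
  have kpos : 0 < k := by linarith
  have npos : 0 < n := by linarith
  have mpos : 0 < m := by linarith
  set Λ : ℝ := Real.log n with hΛ
  have hΛ1 : 0.69 ≤ Λ := by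
    have h1 : Real.log 2 ≤ Real.log n := Real.log_le_log (by norm_num) hn0
    linarith [Real.log_two_gt_d9]
  have Λpos : 0 < Λ := by linarith
  -- The squared correlation divided by `n` is `k m (k κ)`, so it dominates twice the diagonal loss
  -- `k m` once `k κ ≥ 2`. For `k κ < 2` the claim is trivial.
  set κ : ℝ := θ ^ 2 * m / n with hκ
  have κpos : 0 < κ := by positivity
  have hθ2 : θ ^ 2 ≤ 1 := pow_le_one₀ hθ.le hθ1
  have κle : κ ≤ 1 := by
    rw [hκ, div_le_one npos]
    calc θ ^ 2 * m ≤ 1 * m := by gcongr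
      _ ≤ n := by linarith
  have hfinal : k ^ 3 * κ ^ 8 ≤
      54000 * (1536 ^ 2 * 1024) ^ 2 * Λ ^ 3 * n ^ 3 / (θ ^ 2 * m ^ 2) →
      k ^ 3 * θ ^ 18 * m ^ 10 ≤ 54000 * (1536 ^ 2 * 1024) ^ 2 * n ^ 11 * Λ ^ 3 := fun h => by
    rw [hκ, div_pow, mul_div_assoc', div_le_div_iff₀ (by positivity) (by positivity)] at h
    calc _ = k ^ 3 * (θ ^ 2 * m) ^ 8 * (θ ^ 2 * m ^ 2) := by ring
      _ ≤ _ := h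
      _ = _ := by ring
  apply hfinal
  rcases lt_or_ge (k * κ) 2 with hsmall | hbig
  · have h1 : k ^ 3 * κ ^ 8 ≤ 8 := by
      calc k ^ 3 * κ ^ 8 = (k * κ) ^ 3 * κ ^ 5 := by ring
        _ ≤ 2 ^ 3 * 1 := by
          gcongr
          exact pow_le_one₀ κpos.le κle
        _ = 8 := by norm_num
    refine h1.trans ?_
    rw [le_div_iff₀ (by positivity)]
    have h2 : θ ^ 2 * m ^ 2 ≤ n ^ 2 := by
      calc θ ^ 2 * m ^ 2 ≤ 1 * n ^ 2 := by gcongr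
        _ = _ := one_mul _
    have h3 : n ^ 2 ≤ n ^ 3 := pow_le_pow_right₀ (by linarith) (by norm_num)
    have h4 : (0.69 : ℝ) ^ 3 ≤ Λ ^ 3 := by gcongr
    calc 8 * (θ ^ 2 * m ^ 2) ≤ 54000 * (1536 ^ 2 * 1024) ^ 2 * 0.69 ^ 3 * n ^ 3 := by
          have h5 : 0 < n ^ 3 := by positivity
          linarith [h2.trans h3]
      _ ≤ _ := by gcongr
  have dpos : 0 < d := by rw [hd]; positivity
  have hdm : 4 * k ≤ d * m := by
    have : d * m = 6000 * n * Λ / θ ^ 2 := by rw [hd]; field_simp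
    rw [this, le_div_iff₀ (by positivity)]
    calc 4 * k * θ ^ 2 ≤ 4 * n * 1 := by gcongr
      _ ≤ 6000 * n * 0.69 := by linarith
      _ ≤ _ := by gcongr
  -- At density `r` the degree bound `4 m k r²` equals `d`. Together with `r ≥ 1 / m`, any density
  -- `ρ ≥ r` makes `μ = 4 m k ρ²` dominate both `d` and `4 k ρ`, so the degree's second moment is at
  -- most `3 μ²`.
  set r : ℝ := √(d / (4 * m * k)) with hr
  have hr2 : r ^ 2 = d / (4 * m * k) := Real.sq_sqrt (by positivity)
  have hrm : 1 / m ≤ r := by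
    rw [hr]
    refine Real.le_sqrt_of_sq_le ?_
    rw [div_pow, one_pow, div_le_div_iff₀ (by positivity) (by positivity)]
    calc 1 * (4 * m * k) = 4 * k * m := by ring
      _ ≤ d * m * m := by gcongr
      _ = d * m ^ 2 := by ring
  have rpos : 0 < r := lt_of_lt_of_le (by positivity) hrm
  have hrm1 : 1 ≤ r * m := by rwa [div_le_iff₀ mpos] at hrm
  have hR1 : 1 ≤ 3 * n * r := by
    calc 1 ≤ r * m := hrm1
      _ ≤ r * (3 * n) := by gcongr; linarith
      _ = _ := mul_comm _ _
  set ℓ : ℕ := ⌈3 * n * r⌉₊ with hℓ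
  have hℓ1 : 3 * n * r ≤ ℓ := Nat.le_ceil _
  have hℓ2 : (ℓ : ℝ) ≤ 2 * (3 * n * r) := by
    have := Nat.ceil_lt_add_one (a := 3 * n * r) (by positivity)
    linarith
  set ρ : ℝ := ℓ / (3 * n) with hρ
  have hρr : r ≤ ρ := by rw [hρ, le_div_iff₀ (by positivity)]; linarith
  have ρpos : 0 < ρ := by linarith
  set μ : ℝ := 4 * m * k * ρ ^ 2 with hμ
  have μpos : 0 < μ := by positivity
  have hdμ : d ≤ μ := by
    calc d = 4 * m * k * r ^ 2 := by rw [hr2]; field_simp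
      _ ≤ μ := by rw [hμ]; gcongr
  have hkμ : 4 * k * ρ ≤ μ := by
    have h1 : 1 ≤ m * ρ := by
      calc 1 ≤ r * m := hrm1
        _ ≤ ρ * m := by gcongr
        _ = _ := mul_comm _ _
    calc 4 * k * ρ = 4 * k * ρ * 1 := by ring
      _ ≤ 4 * k * ρ * (m * ρ) := by gcongr
      _ = μ := by rw [hμ]; ring
  set X : ℝ := √(128 * k * (2 * ℓ * Real.log (3 * n) + 1)) with hX
  -- With this `D` the pruning loss is at most `μ k κ / 16`, half of the lower bound `μ k κ / 8` for
  -- the left side.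
  have h1 := hT ℓ ρ (96 * μ / κ) (by positivity) rfl
  have h2 : μ * k * κ / 8 ≤ ρ ^ 2 * ((θ * m * k) ^ 2 / n - k * m) := by
    have e1 : (θ * m * k) ^ 2 / n = k * m * (k * κ) := by rw [hκ]; field_simp
    have e2 : μ * k * κ / 8 = ρ ^ 2 * (k * m * (k * κ) / 2) := by rw [hμ]; ring
    rw [e1, e2]
    refine mul_le_mul_of_nonneg_left ?_ (sq_nonneg _)
    have : 0 ≤ k * m * (k * κ - 2) := mul_nonneg (by positivity) (by linarith)
    linarith
  have h3 : 2 / (96 * μ / κ) * (k * (μ * (μ + 4 * k * ρ + d))) ≤ μ * k * κ / 16 := by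
    calc _ ≤ 2 / (96 * μ / κ) * (k * (μ * (μ + μ + μ))) := by gcongr
      _ = μ * k * κ / 16 := by field_simp; ring
  have h4 : k * κ ^ 2 ≤ 1536 * X := by
    have h5 : μ * (k * κ / 16) ≤ μ * (96 / κ * X) := by
      have : 96 * μ / κ * X = μ * (96 / κ * X) := by ring
      linarith
    have h6 := le_of_mul_le_mul_left h5 μpos
    rw [div_mul_eq_mul_div, le_div_iff₀ κpos] at h6
    have h7 : k * κ / 16 * κ = k * κ ^ 2 / 16 := by ring
    linarith
  have hlog : Real.log (3 * n) ≤ 3 * Λ := log_three_mul_le hn0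
  have hℓ0 : (1 : ℝ) ≤ ℓ := by linarith
  have hinner : 2 * ℓ * Real.log (3 * n) + 1 ≤ 8 * (ℓ * Λ) := by
    have h5 : 2 * ℓ * Real.log (3 * n) ≤ 2 * ℓ * (3 * Λ) := by gcongr
    have h6 : 1 * 0.69 ≤ ℓ * Λ := by gcongr
    linarith
  have hlog0 : 0 ≤ Real.log (3 * n) := Real.log_nonneg (by linarith)
  have h5 : k * κ ^ 4 ≤ 1536 ^ 2 * 1024 * (ℓ * Λ) := by
    have h6 : (k * κ ^ 2) ^ 2 ≤ (1536 * X) ^ 2 := pow_le_pow_left₀ (by positivity) h4 2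
    rw [mul_pow 1536, hX, Real.sq_sqrt (by positivity)] at h6
    have h7 : k * (k * κ ^ 4) ≤ k * (1536 ^ 2 * 1024 * (ℓ * Λ)) := by
      calc k * (k * κ ^ 4) = (k * κ ^ 2) ^ 2 := by ring
        _ ≤ _ := h6
        _ ≤ 1536 ^ 2 * (128 * k * (8 * (ℓ * Λ))) := by gcongr
        _ = _ := by ring
    exact le_of_mul_le_mul_left h7 kpos
  have h6 : k ^ 2 * κ ^ 8 ≤ (1536 ^ 2 * 1024) ^ 2 * Λ ^ 2 * (9 * n ^ 2 * d / (m * k)) := by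
    calc k ^ 2 * κ ^ 8 = (k * κ ^ 4) ^ 2 := by ring
      _ ≤ (1536 ^ 2 * 1024 * (2 * (3 * n * r) * Λ)) ^ 2 := by
        refine pow_le_pow_left₀ (by positivity) (h5.trans ?_) 2
        gcongr
      _ = (1536 ^ 2 * 1024) ^ 2 * Λ ^ 2 * (36 * n ^ 2 * r ^ 2) := by ring
      _ = _ := by rw [hr2]; field_simp; ring
  calc k ^ 3 * κ ^ 8 = k * (k ^ 2 * κ ^ 8) := by ring
    _ ≤ k * ((1536 ^ 2 * 1024) ^ 2 * Λ ^ 2 * (9 * n ^ 2 * d / (m * k))) := by gcongr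
    _ = _ := by rw [hd]; field_simp; ring

/-- The bound for codes in normal form. -/
lemma IsLocallyDecodable.exists_cube_le {k n : ℕ} {δ ε : ℝ} {C : (Fin k → Bool) → (Fin n → Bool)}
    (hC : IsLocallyDecodable 3 δ ε C) (hδ : 0 < δ) (hε : 0 < ε) (hk : 1 ≤ k) (hn : 2 ≤ n) :
    ∃ m : ℕ, m ≤ n ∧ δ * n ≤ 3 * m ∧ (k : ℝ) ^ 3 * (ε / 16) ^ 18 * m ^ 10 ≤
      54000 * (1536 ^ 2 * 1024) ^ 2 * n ^ 11 * Real.log n ^ 3 := by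
  classical
  obtain ⟨m, col, vtx, s, hδm, hcol, hvtx, hs, hcorr⟩ := hC.exists_normalForm hε
  have hε1 : ε ≤ 1 := hC.le_one hδ ⟨0, hk⟩
  have hmn : m ≤ n := by
    simpa using Fintype.card_le_of_injective _ (hcol ⟨0, hk⟩)
  have hn0 : (2 : ℝ) ≤ n := by exact_mod_cast hn
  have hm : 1 ≤ m := by
    by_contra h
    have hm0 : m = 0 := by omega
    subst hm0
    have : 0 < δ * n := by positivity
    simp at hδm
    linarith
  refine ⟨m, hmn, hδm, ?_⟩
  have hk0 : (1 : ℝ) ≤ k := by exact_mod_cast hk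
  have hm0 : (1 : ℝ) ≤ m := by exact_mod_cast hm
  set θ : ℝ := ε / 16 with hθ
  have θpos : 0 < θ := by positivity
  have hlog : 0.69 ≤ Real.log n := by
    have h1 : Real.log 2 ≤ Real.log n := Real.log_le_log (by norm_num) hn0
    linarith [Real.log_two_gt_d9]
  set d : ℝ := 6000 * n * Real.log n / (θ ^ 2 * m) with hd
  have dpos : 0 < d := by positivity
  have : NeZero n := ⟨by omega⟩
  have : NeZero m := ⟨by omega⟩
  have : NeZero k := ⟨by omega⟩
  have hheavy := sum_heavy_le col hcol vtx hvtx s hs (fun b u => bitSign (C b u))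
    (fun b u => bitSign_mul_self _) (fun b v => paddedSign (C b) v)
    (fun b v => paddedSign_mul_self _ _) dpos
  simp only [Fintype.card_fin, Fintype.card_prod, Nat.cast_mul, Nat.cast_ofNat] at hheavy
  -- The constant 6000 in `d` exceeds `2 · 3 · 128 · 7 = 5376`, so heavy triples account for at most
  -- half of the correlation `ε / 8 = 2 θ`.
  have hheavy_le : √(2 * m * k / d * (n * 3)) *
      √(128 * k * (Real.log (n * (n * 3) + n * 3) + 1)) ≤ θ * m * k := by
    rw [← Real.sqrt_mul (by positivity)]
    refine Real.sqrt_le_iff.2 ⟨by positivity, ?_⟩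
    have h1 : Real.log (n * (n * 3) + n * 3) ≤ 5 * Real.log n := by
      have h2 : (n : ℝ) * (n * 3) + n * 3 ≤ n ^ 5 := by
        have h3 : (8 : ℝ) ≤ n ^ 3 := by
          calc (8 : ℝ) = 2 ^ 3 := by norm_num
            _ ≤ n ^ 3 := by gcongr
        nlinarith [mul_le_mul_of_nonneg_right h3 (sq_nonneg (n : ℝ))]
      calc _ ≤ Real.log ((n : ℝ) ^ 5) := Real.log_le_log (by positivity) h2
        _ = _ := by rw [Real.log_pow]; norm_num
    have h2 : Real.log (n * (n * 3) + n * 3) + 1 ≤ 7 * Real.log n := by linarith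
    calc 2 * m * k / d * (n * 3) * (128 * k * (Real.log (n * (n * 3) + n * 3) + 1))
        ≤ 2 * m * k / d * (n * 3) * (128 * k * (7 * Real.log n)) := by gcongr
      _ = 5376 / 6000 * (θ * m * k) ^ 2 := by
        have : Real.log n ≠ 0 := by positivity
        rw [hd]; field_simp; ring
      _ ≤ _ := by
        have := sq_nonneg (θ * m * k)
        linarith
  have hlight : 2 ^ k * (θ * m * k) ≤ ∑ b : Fin k → Bool, ∑ i, bitSign (b i) *
      ∑ e, (if IsHeavy col vtx d i e then 0 else s i e) *
        (bitSign (C b (col i e)) * paddedSign (C b) (vtx i (e, false)) *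
          paddedSign (C b) (vtx i (e, true))) := by
    have e1 : ∀ (b : Fin k → Bool) (i : Fin k), bitSign (b i) * ∑ e, s i e *
        (bitSign (C b (col i e)) * paddedSign (C b) (vtx i (e, false)) *
          paddedSign (C b) (vtx i (e, true))) =
        bitSign (b i) * ∑ e, (if IsHeavy col vtx d i e then s i e else 0) *
        (bitSign (C b (col i e)) * paddedSign (C b) (vtx i (e, false)) *
          paddedSign (C b) (vtx i (e, true))) +
        bitSign (b i) * ∑ e, (if IsHeavy col vtx d i e then 0 else s i e) *
        (bitSign (C b (col i e)) * paddedSign (C b) (vtx i (e, false)) *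
          paddedSign (C b) (vtx i (e, true))) := fun b i => by
      rw [← mul_add, ← Finset.sum_add_distrib]
      congr 1
      exact Finset.sum_congr rfl fun e _ => by split_ifs <;> ring
    simp only [e1, Finset.sum_add_distrib] at hcorr
    have h2 : (2 : ℝ) ^ k * (√(2 * m * k / d * (n * 3)) *
      √(128 * k * (Real.log (n * (n * 3) + n * 3) + 1))) ≤ 2 ^ k * (θ * m * k) := by gcongr
    have h3 : (2 : ℝ) ^ k * (ε / 8 * m * k) = 2 ^ k * (θ * m * k) + 2 ^ k * (θ * m * k) := by
      rw [hθ]; ring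
    linarith
  refine cube_le_of_tradeoff hk (hC.le_length hδ hε) hn hm hmn θpos (by linarith) hd
    fun ℓ ρ D hD hρ => ?_
  have h := light_tradeoff ℓ hcol hvtx (s := fun i e => if IsHeavy col vtx d i e then 0 else s i e)
    (fun i e => by
      split_ifs
      · simp
      · exact hs i e)
    (d := d) (ρ := ρ) dpos.le hD (by simp [hρ, mul_comm])
    (fun i e he c => by
      by_contra hlt
      exact he (if_pos ⟨c, not_le.1 hlt⟩))
    (fun b u => bitSign (C b u))
    (fun b u => bitSign_mul_self _) (fun b v => paddedSign (C b) v)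
    (fun b v => paddedSign_mul_self _ _) (A := θ * m * k) (by positivity)
    (by simpa only [Fintype.card_fin] using hlight)
  simp only [Fintype.card_fin, Fintype.card_prod, Nat.cast_mul, Nat.cast_ofNat] at h
  rw [mul_comm (3 : ℝ)]
  exact h

theorem theorem1 :
    (∃ K : ℝ, 0 < K ∧
      ∀ (k n : ℕ) (δ ε : ℝ) (C : (Fin k → Bool) → (Fin n → Bool)),
        2 ≤ n → 0 < δ → 0 < ε → IsLocallyDecodable 3 δ ε C →
          (k : ℝ) ^ 3 ≤ (n : ℝ) * (K * (Real.log (n : ℝ) ^ 6 / (ε ^ 32 * δ ^ 16)))) ∧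
    (∀ δ ε : ℝ, 0 < δ → 0 < ε →
      ∃ c : ℝ, 0 < c ∧
        ∀ (k n : ℕ) (C : (Fin k → Bool) → (Fin n → Bool)),
          2 ≤ k → IsLocallyDecodable 3 δ ε C →
            c * ((k : ℝ) ^ 3 / Real.log (k : ℝ) ^ 6) ≤ (n : ℝ)) := by
  have part1 : ∃ K : ℝ, 0 < K ∧
      ∀ (k n : ℕ) (δ ε : ℝ) (C : (Fin k → Bool) → (Fin n → Bool)),
        2 ≤ n → 0 < δ → 0 < ε → IsLocallyDecodable 3 δ ε C →
          (k : ℝ) ^ 3 ≤ (n : ℝ) * (K * (Real.log (n : ℝ) ^ 6 / (ε ^ 32 * δ ^ 16))) := by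
    -- The powers of 16 and 3 undo `θ = ε / 16` and `m ≥ δ n / 3`, with a further `3 ^ 6` from `δ ≤
    -- 3`; the 4 comes from `1 ≤ 4 log³ n`. The sharper exponents 18, 10 and 3 are relaxed to 32, 16
    -- and 6.
    refine ⟨54000 * (1536 ^ 2 * 1024) ^ 2 * 16 ^ 18 * 3 ^ 16 * 4, by positivity, ?_⟩
    intro k n δ ε C hn hδ hε hC
    have hn0 : (2 : ℝ) ≤ n := by exact_mod_cast hn
    have hlog : 0.69 ≤ Real.log n := by
      have h1 : Real.log 2 ≤ Real.log n := Real.log_le_log (by norm_num) hn0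
      linarith [Real.log_two_gt_d9]
    rcases Nat.eq_zero_or_pos k with rfl | hk
    · simp only [Nat.cast_zero]
      rw [zero_pow (by norm_num)]
      positivity
    have hε1 : ε ≤ 1 := hC.le_one hδ ⟨0, hk⟩
    obtain ⟨m, hmn, hδm, h⟩ := hC.exists_cube_le hδ hε hk hn
    have hmn0 : (m : ℝ) ≤ n := by exact_mod_cast hmn
    have npos : (0 : ℝ) < n := by linarith
    have hδ3 : δ ≤ 3 := by
      refine le_of_mul_le_mul_right ?_ npos
      linarith
    have hm : δ * n / 3 ≤ m := by linarith
    have h1 : (k : ℝ) ^ 3 * (ε / 16) ^ 18 * (δ / 3) ^ 10 ≤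
        54000 * (1536 ^ 2 * 1024) ^ 2 * n * Real.log n ^ 3 := by
      have h2 : (n : ℝ) ^ 10 * ((k : ℝ) ^ 3 * (ε / 16) ^ 18 * (δ / 3) ^ 10) ≤
          n ^ 10 * (54000 * (1536 ^ 2 * 1024) ^ 2 * n * Real.log n ^ 3) := by
        calc _ = (k : ℝ) ^ 3 * (ε / 16) ^ 18 * (δ * n / 3) ^ 10 := by ring
          _ ≤ (k : ℝ) ^ 3 * (ε / 16) ^ 18 * m ^ 10 := by gcongr
          _ ≤ _ := h
          _ = _ := by ring
      exact le_of_mul_le_mul_left h2 (by positivity)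
    have h3 : 1 ≤ 4 * Real.log n ^ 3 := by
      calc (1 : ℝ) ≤ 4 * 0.69 ^ 3 := by norm_num
        _ ≤ _ := by gcongr
    have hε14 : ε ^ 14 ≤ 1 := pow_le_one₀ hε.le hε1
    have hδ6 : δ ^ 6 ≤ 3 ^ 6 := pow_le_pow_left₀ hδ.le hδ3 6
    rw [mul_div_assoc', mul_div_assoc', le_div_iff₀ (by positivity)]
    calc (k : ℝ) ^ 3 * (ε ^ 32 * δ ^ 16)
        = ((k : ℝ) ^ 3 * (ε / 16) ^ 18 * (δ / 3) ^ 10) * (16 ^ 18 * 3 ^ 10) * (ε ^ 14 * δ ^ 6) := by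
          ring
      _ ≤ (54000 * (1536 ^ 2 * 1024) ^ 2 * n * Real.log n ^ 3) * (16 ^ 18 * 3 ^ 10) *
          (1 * 3 ^ 6) := by gcongr
      _ = (54000 * (1536 ^ 2 * 1024) ^ 2 * n * Real.log n ^ 3) * (16 ^ 18 * 3 ^ 10) *
          (1 * 3 ^ 6) * 1 := by ring
      _ ≤ (54000 * (1536 ^ 2 * 1024) ^ 2 * n * Real.log n ^ 3) * (16 ^ 18 * 3 ^ 10) *
          (1 * 3 ^ 6) * (4 * Real.log n ^ 3) := by gcongr
      _ = _ := by ring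
  refine ⟨part1, fun δ ε hδ hε => ?_⟩
  obtain ⟨K, hK, hbound⟩ := part1
  have hlog2 : 0 < Real.log 2 := Real.log_pos (by norm_num)
  refine ⟨min (Real.log 2 ^ 6) (ε ^ 32 * δ ^ 16 / (729 * K)), by positivity, ?_⟩
  intro k n C hk hC
  have hkn : k ≤ n := hC.le_length hδ hε
  have hk0 : (2 : ℝ) ≤ k := by exact_mod_cast hk
  have hn0 : (2 : ℝ) ≤ n := by exact_mod_cast hk.trans hkn
  have hlogk : Real.log 2 ≤ Real.log k := Real.log_le_log (by norm_num) hk0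
  have hlogk0 : 0 < Real.log k := by linarith
  rw [mul_div_assoc', div_le_iff₀ (by positivity)]
  -- If `k³ ≤ n`, the bound `log k ≥ log 2` suffices. Otherwise `log n ≤ 3 log k`, whose sixth power
  -- is the source of `729 = 3 ^ 6`.
  rcases le_or_gt ((k : ℝ) ^ 3) n with h | h
  · calc _ ≤ Real.log 2 ^ 6 * (k : ℝ) ^ 3 := by gcongr; exact min_le_left _ _
      _ ≤ Real.log k ^ 6 * n := by gcongr
      _ = _ := mul_comm _ _
  · have h1 := hbound k n δ ε C (hk.trans hkn) hδ hε hC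
    have h2 : Real.log n ≤ 3 * Real.log k := by
      calc Real.log n ≤ Real.log ((k : ℝ) ^ 3) := Real.log_le_log (by linarith) h.le
        _ = _ := by rw [Real.log_pow]; norm_num
    have hlogn : 0 ≤ Real.log n := Real.log_nonneg (by linarith)
    calc _ ≤ ε ^ 32 * δ ^ 16 / (729 * K) * (k : ℝ) ^ 3 := by gcongr; exact min_le_right _ _
      _ ≤ ε ^ 32 * δ ^ 16 / (729 * K) *
          ((n : ℝ) * (K * (Real.log (n : ℝ) ^ 6 / (ε ^ 32 * δ ^ 16)))) := by gcongr
      _ ≤ ε ^ 32 * δ ^ 16 / (729 * K) *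
          ((n : ℝ) * (K * ((3 * Real.log k) ^ 6 / (ε ^ 32 * δ ^ 16)))) := by gcongr
      _ = _ := by field_simp; ring
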